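/- Corollary 4.1. Write $1/\infty=0$. For a function $f$ on $[0,1]$ let $f^*$ be the non-increasing rearrangement of $|f|$; for a family $c=(c_n)_{n\in I}$ of complex numbers let $(c_k^*)_{k\ge 1}$ be the non-increasing rearrangement of $(|c_n|)_{n\in I}$. For $0<q\le\infty$ and real $\alpha,\beta$ put $$\|c\|_{l_{2,q}(\log l)_\beta}=\Big\|\,\big(k^{1/2-1/q}(1+\log k)^\beta c_k^*\big)_{k\ge 1}\Big\|_{l_q},\qquad \|f\|_{L^{\mathcal L}_{2,q,\alpha,2}}=\Big\|\,t^{-1/q}(1+|\log t|)^\alpha\,\|f^*\|_{L_2(0,t)}\Big\|_{L_q(0,1)}$$ (with $L_q(0,1)$ taken in the variable $t$), and let $l_{2,q}(\log l)_\beta$ and $L^{\mathcal L}_{2,q,\alpha,2}$ be the spaces of all families $c$, respectively of all measurable functions $f:[0,1]\to\mathbb C$, for which these expressions are finite. Let $0<q\le\infty$, $\alpha>-1/q$ and $\varepsilon>0$. There is a constant $C>0$, depending only on $q,\alpha,\varepsilon$, with the following property. Let $(\varphi_n)_{n\in I}$, with $I$ a countably infinite index set (such as $\mathbb N$ or $\mathbb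 Z$), be an orthonormal system in $L_2(0,1)$ with $M:=\sup_n\|\varphi_n\|_{L_\infty}<\infty$. Then for every $c\in l_{2,q}(\log l)_{\alpha+1/\min(q,2)}$ the series $\mathcal F^{-1}c:=\sum_{n} c_n\varphi_n$ converges unconditionally in $L_2(0,1)$, its sum belongs to $L^{\mathcal L}_{2,q,\alpha,2}$, and $$\|\mathcal F^{-1}c\|_{L^{\mathcal L}_{2,q,\alpha,2}}\le C\,\min\big(M,(1+\log M)^{|\alpha|+\varepsilon+1/q}\big)\,\|c\|_{l_{2,q}(\log l)_{\alpha+1/\min(q,2)}}.$$ -/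

import Mathlib

open MeasureTheory Set
open scoped ENNReal

noncomputable section

/-- Lebesgue measure on `[0,1]`. -/
abbrev unitVol : Measure ℝ := volume.restrict (Icc (0 : ℝ) 1)

/-- The non-increasing rearrangement on `[0,1]`: `f^*(t) = inf {s ≥ 0 : |{x : |f x| > s}| ≤ t}`. -/
def fnRearr (f : ℝ → ℂ) (t : ℝ) : ℝ≥0∞ :=
  sInf {s : ℝ≥0∞ | unitVol {x | s < ‖f x‖ₑ} ≤ ENNReal.ofReal t}

/-- The non-increasing rearrangement of a family of numbers; for `k ≥ 1`, the `k`-th term is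
`c_k^* = inf {s ≥ 0 : #{n : |c n| > s} < k}`, the `k`-th largest modulus. -/
def seqRearr {ι : Type*} (c : ι → ℂ) (k : ℕ) : ℝ≥0∞ :=
  sInf {s : ℝ≥0∞ | {n | s < ‖c n‖ₑ}.encard < k}

/-- The reciprocal `1/q` of an exponent `0 < q ≤ ∞`, with `1/∞ = 0`. -/
def recip (q : ℝ≥0∞) : ℝ := (q⁻¹).toReal

/-- The (quasi-)norm of the Lorentz–Zygmund sequence space `l_{p,q}(log l)_α`:
the `l_q` (quasi-)norm of `k^{1/p-1/q} (1 + log k)^α c_k^*`, `k = 1, 2, …`. -/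
def lzSeqNorm {ι : Type*} (p q : ℝ≥0∞) (α : ℝ) (c : ι → ℂ) : ℝ≥0∞ :=
  eLpNorm (fun j : ℕ =>
    ENNReal.ofReal (((j + 1 : ℕ) : ℝ) ^ (recip p - recip q)
      * (1 + Real.log ((j + 1 : ℕ) : ℝ)) ^ α) * seqRearr c (j + 1)) q Measure.count

/-- The Lorentz–Zygmund sequence space `l_{p,q}(log l)_α`. -/
def lzSeq (ι : Type*) (p q : ℝ≥0∞) (α : ℝ) : Set (ι → ℂ) :=
  {c | lzSeqNorm p q α c < ∞}

/-- The (quasi-)norm of the function space `L^𝓛_{p,q,α,r}`: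
`‖ t^{-1/q} (1 + |log t|)^α ‖ u^{1/p-1/r} f^*(u) | L_r(0,t) ‖ | L_q(0,1) ‖`. -/
def leftNorm (p q : ℝ≥0∞) (α : ℝ) (r : ℝ≥0∞) (f : ℝ → ℂ) : ℝ≥0∞ :=
  eLpNorm (fun t : ℝ =>
    ENNReal.ofReal (t ^ (-recip q) * (1 + |Real.log t|) ^ α)
      * eLpNorm (fun u : ℝ => ENNReal.ofReal (u ^ (recip p - recip r)) * fnRearr f u) r
          (volume.restrict (Ioo 0 t))) q (volume.restrict (Ioo 0 1))

/-- The function space `L^𝓛_{p,q,α,r}` on `[0,1]`. -/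
def leftSpace (p q : ℝ≥0∞) (α : ℝ) (r : ℝ≥0∞) : Set (ℝ → ℂ) :=
  {f | AEStronglyMeasurable f unitVol ∧ leftNorm p q α r f < ∞}

/-- The map `𝓕⁻¹ : c ↦ ∑ c_n φ_n`; the series is (unconditionally) summed in `L_2(0,1)`. -/
def fourierInv {ι : Type*} (φ : ι → Lp ℂ 2 unitVol) (c : ι → ℂ) : Lp ℂ 2 unitVol :=
  ∑' n, c n • φ n

end

/-! Put `b l = block c l`, that is 2^l c*_{4^l}. For a cut `i`, split the series along the set of
indices where |c_n| exceeds c*_{4^i}; this set has fewer than 4^i elements. If K bounds the system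
uniformly, the finite head is at most 4K ∑_{l<i} 2^l b_l almost everywhere. By orthonormality the
rest has L_2 norm at most 2 (∑_{l≥i} b_l²)^{1/2}. Passing to rearrangements gives the central
estimate `eLpNorm_fnRearr_fourierInv_le`, valid for every t and every cut.

Take t = 4^{-j} and K = 2^m ≥ M. Cutting at i = j - m instead of j absorbs K completely, since √t K
2^l = 2^{-(i-l)}. The resulting bound is `U (j - m)` with `U` independent of the system, so M enters
only through a shift by m. That shift costs (m+1)^{|α|+1/q} (`eLpNorm_shift_le`), and m comparable
to log M gives both alternatives of the minimum, because powers of 1 + log M are O(M).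

It remains to bound `U` in the weighted l_q norm by discrete Hardy inequalities. The geometrically
damped head loses nothing (`hardy_head`). The tail of squares needs α > -1/q and raises the weight
exponent by 1/min(q,2) (`hardy_tail`). The continuous and the sequence norm are brought to the scale
of powers of 4 by `eLpNorm_log_weight_le` and `eLpNorm_block_le`; there both logarithmic weights
become powers of j + 1. Finiteness of the tail at i = 0 also gives c ∈ l_2, hence unconditional
convergence. -/

/-! ### Power weights and unweighted-exponent Hardy inequalities for tails. -/

/-- The power weight `(j + 1)^a`. -/
noncomputable def powWeight (a : ℝ) (j : ℕ) : ℝ≥0∞ := ENNReal.ofReal (((j : ℝ) + 1) ^ a)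

lemma powWeight_add (a b : ℝ) (j : ℕ) :
    powWeight (a + b) j = powWeight a j * powWeight b j := by
  unfold powWeight
  rw [Real.rpow_add (by positivity), ENNReal.ofReal_mul (by positivity)]

lemma powWeight_rpow (a p : ℝ) (j : ℕ) : powWeight a j ^ p = powWeight (a * p) j := by
  unfold powWeight
  rw [ENNReal.ofReal_rpow_of_pos (by positivity), ← Real.rpow_mul (by positivity)]

@[simp] lemma powWeight_zero_left (j : ℕ) : powWeight 0 j = 1 := by simp [powWeight]

@[simp] lemma powWeight_zero_right (a : ℝ) : powWeight a 0 = 1 := by simp [powWeight]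

lemma powWeight_mul_neg (a : ℝ) (j : ℕ) : powWeight a j * powWeight (-a) j = 1 := by
  rw [← powWeight_add]; simp

/-- For γ ≥ 1 the last term is the largest. For γ < 1 the increments of (l+1)^γ dominate γ times the
terms, and the sum telescopes. -/
lemma sum_powWeight_le {γ : ℝ} (hγ : 0 < γ) :
    ∃ C : ℝ≥0∞, C ≠ ∞ ∧ ∀ l : ℕ,
      ∑ i ∈ Finset.range (l + 1), powWeight (γ - 1) i ≤ C * powWeight γ l := by
  rcases le_or_gt 1 γ with h1 | h1
  · refine ⟨1, by simp, fun l => ?_⟩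
    calc ∑ i ∈ Finset.range (l + 1), powWeight (γ - 1) i
        ≤ ∑ i ∈ Finset.range (l + 1), powWeight (γ - 1) l := by
          refine Finset.sum_le_sum fun i hi => ENNReal.ofReal_le_ofReal ?_
          have : (i : ℝ) ≤ l := by exact_mod_cast Nat.lt_succ_iff.mp (Finset.mem_range.mp hi)
          exact Real.rpow_le_rpow (by positivity) (by linarith) (by linarith)
      _ = powWeight 1 l * powWeight (γ - 1) l := by
          simp only [Finset.sum_const, Finset.card_range, nsmul_eq_mul]
          congr 1
          unfold powWeight
          rw [Real.rpow_one, ← Nat.cast_succ, ENNReal.ofReal_natCast]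
      _ = 1 * powWeight γ l := by rw [← powWeight_add]; ring_nf
  · refine ⟨ENNReal.ofReal γ⁻¹, by simp, fun l => ?_⟩
    have key : ∀ l : ℕ, ∑ i ∈ Finset.range (l + 1), ((i : ℝ) + 1) ^ (γ - 1)
        ≤ γ⁻¹ * ((l : ℝ) + 1) ^ γ := by
      have step : ∀ x : ℝ, 0 ≤ x → x ^ γ + γ * (x + 1) ^ (γ - 1) ≤ (x + 1) ^ γ := by
        intro x hx
        have hx1 : 0 < x + 1 := by linarith
        -- Bernoulli for the concave power, applied to x/(x+1) = 1 - 1/(x+1).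
        have hb := rpow_one_add_le_one_add_mul_self (s := -(1 / (x + 1)))
          (by rw [neg_le_neg_iff, div_le_one hx1]; linarith) hγ.le h1.le
        have e1 : x = (x + 1) * (1 + -(1 / (x + 1))) := by field_simp; ring
        have hn : (0 : ℝ) ≤ 1 + -(1 / (x + 1)) := by
          have : 1 / (x + 1) ≤ 1 := by rw [div_le_one hx1]; linarith
          linarith
        have e2 : x ^ γ = (x + 1) ^ γ * (1 + -(1 / (x + 1))) ^ γ := by
          rw [← Real.mul_rpow hx1.le hn, ← e1]
        have e3 : (x + 1) ^ (γ - 1) = (x + 1) ^ γ / (x + 1) := by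
          rw [Real.rpow_sub_one hx1.ne']
        have hp : 0 < (x + 1) ^ γ := by positivity
        rw [e2, e3]
        have := mul_le_mul_of_nonneg_left hb hp.le
        have e4 : (x + 1) ^ γ * (1 + γ * -(1 / (x + 1))) + γ * ((x + 1) ^ γ / (x + 1))
          = (x + 1) ^ γ := by ring
        linarith
      intro l
      rw [inv_mul_eq_div, le_div_iff₀ hγ]
      induction l with
      | zero => simp; linarith
      | succ l ih =>
        rw [Finset.sum_range_succ]
        have := step (l + 1) (by positivity)
        push_cast
        nlinarith
    unfold powWeight
    rw [← ENNReal.ofReal_mul (by positivity), ← ENNReal.ofReal_sum_of_nonneg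
      (fun i _ => by positivity)]
    exact ENNReal.ofReal_le_ofReal (key l)

/-- Each term is dominated by a decrement of x^{-γ}, so the tail telescopes; the factor 2^{1+γ} pays
for replacing x by x + 1. -/
lemma tsum_powWeight_neg_le {γ : ℝ} (hγ : 0 < γ) :
    ∃ C : ℝ≥0∞, C ≠ ∞ ∧ ∀ i : ℕ,
      ∑' l, powWeight (-1 - γ) (i + l) ≤ C * powWeight (-γ) i := by
  have step : ∀ x : ℝ, 1 ≤ x →
      x ^ (-1 - γ) ≤ (2 ^ (1 + γ) * γ⁻¹) * (x ^ (-γ) - (x + 1) ^ (-γ)) := by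
    intro x hx
    have hx0 : 0 < x := by linarith
    have hx1 : 0 < x + 1 := by linarith
    have e1 : x ^ (-γ) = (x + 1) ^ (-γ) * (x / (x + 1)) ^ (-γ) := by
      rw [← Real.mul_rpow hx1.le (by positivity)]; congr 1; field_simp
    have hlog : 1 + γ / (x + 1) ≤ (x / (x + 1)) ^ (-γ) := by
      rw [Real.rpow_def_of_pos (by positivity)]
      have h1 := Real.log_le_sub_one_of_pos (show 0 < x / (x + 1) by positivity)
      have h2 := Real.add_one_le_exp (Real.log (x / (x + 1)) * -γ)
      have h3 : x / (x + 1) - 1 = -(1 / (x + 1)) := by field_simp; ring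
      rw [h3] at h1
      have h4 : γ / (x + 1) = (1 / (x + 1)) * γ := by ring
      rw [h4]
      nlinarith
    have e2 : (x + 1) ^ (-1 - γ) = (x + 1) ^ (-γ) / (x + 1) := by
      rw [← Real.rpow_sub_one hx1.ne']; ring_nf
    have h5 : γ * (x + 1) ^ (-1 - γ) ≤ x ^ (-γ) - (x + 1) ^ (-γ) := by
      rw [e1, e2]
      have hp : 0 < (x + 1) ^ (-γ) := by positivity
      have := mul_le_mul_of_nonneg_left hlog hp.le
      have e4 : (x + 1) ^ (-γ) * (1 + γ / (x + 1)) =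
        (x + 1) ^ (-γ) + γ * ((x + 1) ^ (-γ) / (x + 1)) := by ring
      linarith
    have h6 : x ^ (-1 - γ) ≤ 2 ^ (1 + γ) * (x + 1) ^ (-1 - γ) := by
      have : (2 * x) ^ (-1 - γ) ≤ (x + 1) ^ (-1 - γ) :=
        Real.rpow_le_rpow_of_nonpos hx1 (by linarith) (by linarith)
      rw [Real.mul_rpow (by norm_num) hx0.le] at this
      calc x ^ (-1 - γ) = 2 ^ (1 + γ) * (2 ^ (-1 - γ) * x ^ (-1 - γ)) := by
            rw [← mul_assoc, ← Real.rpow_add (by norm_num)]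
            ring_nf; simp
        _ ≤ _ := by gcongr
    calc x ^ (-1 - γ) ≤ 2 ^ (1 + γ) * (x + 1) ^ (-1 - γ) := h6
      _ = (2 ^ (1 + γ) * γ⁻¹) * (γ * (x + 1) ^ (-1 - γ)) := by field_simp
      _ ≤ _ := by gcongr
  set K := (2 : ℝ) ^ (1 + γ) * γ⁻¹
  have hK : 0 < K := by positivity
  refine ⟨ENNReal.ofReal K, by simp, fun i => ?_⟩
  rw [ENNReal.tsum_eq_iSup_nat]
  refine iSup_le fun n => ?_
  unfold powWeight
  rw [← ENNReal.ofReal_mul (by positivity), ← ENNReal.ofReal_sum_of_nonneg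
      (fun i _ => by positivity)]
  refine ENNReal.ofReal_le_ofReal ?_
  have : ∑ l ∈ Finset.range n, (((i + l : ℕ) : ℝ) + 1) ^ (-1 - γ)
      ≤ K * (((i : ℝ) + 1) ^ (-γ) - ((i : ℝ) + n + 1) ^ (-γ)) := by
    induction n with
    | zero => simp
    | succ n ih =>
      rw [Finset.sum_range_succ]
      have := step ((i : ℝ) + n + 1) (by linarith [(Nat.cast_nonneg i : (0 : ℝ) ≤ i),
        (Nat.cast_nonneg n : (0 : ℝ) ≤ n)])
      push_cast at ih ⊢
      have e : (i : ℝ) + (n + 1) + 1 = i + n + 1 + 1 := by ring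
      rw [e]
      nlinarith
  refine this.trans ?_
  gcongr
  have : 0 ≤ ((i : ℝ) + n + 1) ^ (-γ) := by positivity
  linarith

lemma tsum_tsum_add_eq (g : ℕ → ℕ → ℝ≥0∞) :
    ∑' i, ∑' l, g i (i + l) = ∑' n, ∑ i ∈ Finset.range (n + 1), g i n := by
  rw [← ENNReal.tsum_prod (f := fun i l => g i (i + l)),
    ← Equiv.tsum_eq Finset.HasAntidiagonal.sigmaAntidiagonalEquivProd, ENNReal.tsum_sigma']
  refine tsum_congr fun n => ?_
  rw [tsum_fintype]
  have := Finset.sum_coe_sort (Finset.HasAntidiagonal.antidiagonal n) (fun p : ℕ × ℕ => g p.1 (p.1 + p.2))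
  simp only [Finset.HasAntidiagonal.sigmaAntidiagonalEquivProd]
  refine this.trans ?_
  rw [Finset.Nat.sum_antidiagonal_eq_sum_range_succ_mk]
  refine Finset.sum_congr rfl fun i hi => ?_
  simp only
  congr 1
  have := Finset.mem_range.mp hi
  omega

lemma sum_range_antidiagonal_tsum_eq (f : ℕ → ℝ≥0∞) (y : ℕ → ℝ≥0∞) :
    ∑' n, ∑ l ∈ Finset.range (n + 1), f (n - l) * y l = (∑' d, f d) * ∑' l, y l := by
  rw [← tsum_tsum_add_eq (fun l n => f (n - l) * y l)]
  simp only [add_tsub_cancel_left, ENNReal.tsum_mul_right, ENNReal.tsum_mul_left]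

lemma ENNReal.tsum_rpow_le_of_le_one {p : ℝ} (hp : 0 < p) (hp1 : p ≤ 1) (a : ℕ → ℝ≥0∞) :
    (∑' l, a l) ^ p ≤ ∑' l, a l ^ p := by
  have fin : ∀ n, (∑ l ∈ Finset.range n, a l) ^ p ≤ ∑ l ∈ Finset.range n, a l ^ p := by
    intro n
    induction n with
    | zero => simp [hp]
    | succ n ih =>
      rw [Finset.sum_range_succ, Finset.sum_range_succ]
      exact (ENNReal.rpow_add_le_add_rpow _ _ hp.le hp1).trans (by gcongr)
  have hlim := (ENNReal.continuous_rpow_const (y := p)).continuousAt.tendsto.comp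
    (ENNReal.tendsto_nat_tsum a)
  exact le_of_tendsto hlim (Filter.Eventually.of_forall fun n =>
    (fin n).trans (ENNReal.sum_le_tsum _))

/-- For p ≤ 1 the p-th power goes inside the sum; exchanging the order of summation then leaves a
partial sum of weights. -/
lemma hardy_of_le_one {p γ : ℝ} (hp : 0 < p) (hp1 : p ≤ 1) (hγ : 0 < γ) :
    ∃ C : ℝ≥0∞, C ≠ ∞ ∧ ∀ a : ℕ → ℝ≥0∞,
      ∑' i, powWeight (γ - 1) i * (∑' l, a (i + l)) ^ p ≤ C * ∑' l, powWeight γ l * a l ^ p := by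
  obtain ⟨C, hC, h⟩ := sum_powWeight_le hγ
  refine ⟨C, hC, fun a => ?_⟩
  calc ∑' i, powWeight (γ - 1) i * (∑' l, a (i + l)) ^ p
      ≤ ∑' i, ∑' l, powWeight (γ - 1) i * a (i + l) ^ p := by
        refine ENNReal.tsum_le_tsum fun i => ?_
        rw [ENNReal.tsum_mul_left]
        gcongr
        exact ENNReal.tsum_rpow_le_of_le_one hp hp1 _
    _ = ∑' n, (∑ i ∈ Finset.range (n + 1), powWeight (γ - 1) i) * a n ^ p := by
        rw [tsum_tsum_add_eq (fun i n => powWeight (γ - 1) i * a n ^ p)]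
        simp only [Finset.sum_mul]
    _ ≤ ∑' n, C * (powWeight γ n * a n ^ p) := by
        refine ENNReal.tsum_le_tsum fun n => ?_
        rw [← mul_assoc]
        gcongr
        exact h n
    _ = _ := ENNReal.tsum_mul_left

/-- Hölder against an auxiliary power weight replaces subadditivity. Half of γ makes the dual weight
summable; the other half keeps the partial sums of weights growing after the exchange of sums. -/
lemma hardy_of_one_lt {p γ : ℝ} (hp : 1 < p) (hγ : 0 < γ) :
    ∃ C : ℝ≥0∞, C ≠ ∞ ∧ ∀ a : ℕ → ℝ≥0∞,
      ∑' i, powWeight (γ - 1) i * (∑' l, a (i + l)) ^ p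
        ≤ C * ∑' l, powWeight (γ - 1 + p) l * a l ^ p := by
  have hp0 : 0 < p := by linarith
  have hpm : 0 < p - 1 := by linarith
  obtain ⟨C₁, hC₁, h₁⟩ := sum_powWeight_le (half_pos hγ)
  set δ := γ / (2 * (p - 1)) with hδ
  have hδ0 : 0 < δ := by positivity
  obtain ⟨C₂, hC₂, h₂⟩ := tsum_powWeight_neg_le hδ0
  -- Chosen so that the dual weight has exponent -θr = -1-δ, whose tail raised to the power p-1 is
  -- of order (i+1)^{-γ/2}.
  set θ := (p - 1 + γ / 2) / p with hθ
  set r := p / (p - 1) with hr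
  have hpr : p.HolderConjugate r := Real.HolderConjugate.conjExponent hp
  have hr0 : 0 < r := by positivity
  have hθr : -θ * r = -1 - δ := by
    rw [hθ, hr, hδ]; field_simp; ring
  have hθp : θ * p = p - 1 + γ / 2 := by rw [hθ]; field_simp
  refine ⟨C₂ ^ (p - 1) * C₁, ENNReal.mul_ne_top (ENNReal.rpow_ne_top_of_nonneg hpm.le hC₂) hC₁,
    fun a => ?_⟩
  have hol : ∀ i, (∑' l, a (i + l)) ^ p ≤
      (∑' l, powWeight (p - 1 + γ / 2) (i + l) * a (i + l) ^ p) *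
        (C₂ ^ (p - 1) * powWeight (-(γ / 2)) i) := by
    intro i
    have h := ENNReal.lintegral_mul_le_Lp_mul_Lq (Measure.count : Measure ℕ) hpr
      (f := fun l => powWeight θ (i + l) * a (i + l)) (g := fun l => powWeight (-θ) (i + l))
      (measurable_of_countable _).aemeasurable (measurable_of_countable _).aemeasurable
    simp only [lintegral_count, Pi.mul_apply] at h
    have e : ∀ l, powWeight θ (i + l) * a (i + l) * powWeight (-θ) (i + l) = a (i + l) := by
      intro l
      rw [mul_right_comm, powWeight_mul_neg, one_mul]
    simp only [e, ENNReal.mul_rpow_of_nonneg _ _ hp0.le, powWeight_rpow, hθr, hθp] at h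
    calc (∑' l, a (i + l)) ^ p ≤ _ := ENNReal.rpow_le_rpow h hp0.le
      _ = (∑' l, powWeight (p - 1 + γ / 2) (i + l) * a (i + l) ^ p) *
            (∑' l, powWeight (-1 - δ) (i + l)) ^ (p - 1) := by
          rw [ENNReal.mul_rpow_of_nonneg _ _ hp0.le, ← ENNReal.rpow_mul, ← ENNReal.rpow_mul]
          have e1 : 1 / p * p = 1 := by field_simp
          have e2 : 1 / r * p = p - 1 := by rw [hr]; field_simp
          rw [e1, e2, ENNReal.rpow_one]
      _ ≤ _ := by
          gcongr
          calc (∑' l, powWeight (-1 - δ) (i + l)) ^ (p - 1)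
              ≤ (C₂ * powWeight (-δ) i) ^ (p - 1) := ENNReal.rpow_le_rpow (h₂ i) hpm.le
            _ = _ := by
              rw [ENNReal.mul_rpow_of_nonneg _ _ hpm.le, powWeight_rpow]
              have e3 : -δ * (p - 1) = -(γ / 2) := by rw [hδ]; field_simp
              rw [e3]
  calc ∑' i, powWeight (γ - 1) i * (∑' l, a (i + l)) ^ p
      ≤ ∑' i, ∑' l, C₂ ^ (p - 1) * (powWeight (γ / 2 - 1) i *
          (powWeight (p - 1 + γ / 2) (i + l) * a (i + l) ^ p)) := by
        refine ENNReal.tsum_le_tsum fun i => ?_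
        rw [ENNReal.tsum_mul_left, ENNReal.tsum_mul_left]
        refine (mul_le_mul_right (hol i) _).trans (le_of_eq ?_)
        have : powWeight (γ / 2 - 1) i = powWeight (γ - 1) i * powWeight (-(γ / 2)) i := by
          rw [← powWeight_add]; ring_nf
        rw [this]; ring
    _ = C₂ ^ (p - 1) * ∑' n, (∑ i ∈ Finset.range (n + 1), powWeight (γ / 2 - 1) i) *
          (powWeight (p - 1 + γ / 2) n * a n ^ p) := by
        simp only [ENNReal.tsum_mul_left]
        congr 1
        simp only [← ENNReal.tsum_mul_left]
        rw [tsum_tsum_add_eq (fun i n => powWeight (γ / 2 - 1) i *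
          (powWeight (p - 1 + γ / 2) n * a n ^ p))]
        simp only [Finset.sum_mul]
    _ ≤ C₂ ^ (p - 1) * ∑' n, C₁ * (powWeight (γ - 1 + p) n * a n ^ p) := by
        refine mul_le_mul_right (ENNReal.tsum_le_tsum fun n => ?_) _
        refine (mul_le_mul_left (h₁ n) _).trans (le_of_eq ?_)
        have : powWeight (γ - 1 + p) n = powWeight (γ / 2) n * powWeight (p - 1 + γ / 2) n := by
          rw [← powWeight_add]; ring_nf
        rw [this]; ring
    _ = _ := by rw [ENNReal.tsum_mul_left, mul_assoc]

/-! ### Quasi-norms of l_q and the weighted Hardy inequalities for all 0 < q ≤ ∞. -/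

lemma eLpNorm_count_top (x : ℕ → ℝ≥0∞) : eLpNorm x ∞ Measure.count = ⨆ i, x i := by
  rw [eLpNorm_exponent_top, eLpNormEssSup_eq_iSup (by simp)]
  rfl

lemma eLpNorm_count_eq {q : ℝ≥0∞} (hq : q ≠ 0) (hq' : q ≠ ∞) (x : ℕ → ℝ≥0∞) :
    eLpNorm x q Measure.count = (∑' i, x i ^ q.toReal) ^ (1 / q.toReal) := by
  rw [eLpNorm_eq_lintegral_rpow_enorm_toReal hq hq', lintegral_count]
  rfl

lemma le_eLpNorm_count {q : ℝ≥0∞} (hq : q ≠ 0) (x : ℕ → ℝ≥0∞) (i : ℕ) :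
    x i ≤ eLpNorm x q Measure.count := by
  by_cases hq' : q = ∞
  · rw [hq', eLpNorm_count_top]; exact le_iSup x i
  · rw [eLpNorm_count_eq hq hq', one_div,
      ENNReal.le_rpow_inv_iff (ENNReal.toReal_pos hq hq')]
    exact ENNReal.le_tsum (f := fun i => x i ^ q.toReal) i

lemma eLpNorm_le_of_lintegral_le {α β : Type*} [MeasurableSpace α] [MeasurableSpace β]
    {μ : Measure α} {ν : Measure β} {q : ℝ≥0∞} (hq : q ≠ 0) (hq' : q ≠ ∞)
    {x : α → ℝ≥0∞} {y : β → ℝ≥0∞} {K : ℝ≥0∞}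
    (h : ∫⁻ i, x i ^ q.toReal ∂μ ≤ K * ∫⁻ i, y i ^ q.toReal ∂ν) :
    eLpNorm x q μ ≤ K ^ (1 / q.toReal) * eLpNorm y q ν := by
  have hr := ENNReal.toReal_pos hq hq'
  rw [eLpNorm_eq_lintegral_rpow_enorm_toReal hq hq',
    eLpNorm_eq_lintegral_rpow_enorm_toReal hq hq', ← ENNReal.mul_rpow_of_nonneg _ _ (by positivity)]
  exact ENNReal.rpow_le_rpow h (by positivity)

lemma eLpNorm_count_le_of_tsum_le {q : ℝ≥0∞} (hq : q ≠ 0) (hq' : q ≠ ∞)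
    {x y : ℕ → ℝ≥0∞} {K : ℝ≥0∞}
    (h : ∑' i, x i ^ q.toReal ≤ K * ∑' i, y i ^ q.toReal) :
    eLpNorm x q Measure.count ≤ K ^ (1 / q.toReal) * eLpNorm y q Measure.count :=
  eLpNorm_le_of_lintegral_le hq hq' (by simpa only [lintegral_count] using h)

lemma eLpNorm_enn_mono {α : Type*} [MeasurableSpace α] {μ : Measure α} {q : ℝ≥0∞}
    {x y : α → ℝ≥0∞} (h : ∀ i, x i ≤ y i) : eLpNorm x q μ ≤ eLpNorm y q μ :=
  eLpNorm_mono_enorm h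

lemma eLpNorm_enn_const_mul {q : ℝ≥0∞} {K : ℝ≥0∞} (x : ℕ → ℝ≥0∞) :
    eLpNorm (fun i => K * x i) q Measure.count = K * eLpNorm x q Measure.count := by
  by_cases hq : q = 0
  · simp [hq]
  by_cases hq' : q = ∞
  · rw [hq', eLpNorm_count_top, eLpNorm_count_top, ENNReal.mul_iSup]
  · have hr := ENNReal.toReal_pos hq hq'
    rw [eLpNorm_count_eq hq hq', eLpNorm_count_eq hq hq']
    simp only [ENNReal.mul_rpow_of_nonneg _ _ hr.le, ENNReal.tsum_mul_left]
    rw [ENNReal.mul_rpow_of_nonneg _ _ (by positivity), ← ENNReal.rpow_mul,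
      mul_one_div_cancel hr.ne', ENNReal.rpow_one]

/-- Discrete weighted Hardy inequality for tails of square sums. -/
lemma hardy_tail {q : ℝ≥0∞} (hq : q ≠ 0) {α : ℝ} (hα : -recip q < α) :
    ∃ C : ℝ≥0∞, C ≠ ∞ ∧ ∀ b : ℕ → ℝ≥0∞,
      eLpNorm (fun i => powWeight α i * (∑' l, b (i + l) ^ 2) ^ (1 / 2 : ℝ)) q Measure.count
        ≤ C * eLpNorm (fun i => powWeight (α + recip (min q 2)) i * b i) q Measure.count := by
  by_cases hq' : q = ∞
  · subst hq'
    have hα' : 0 < α := by simpa [recip] using hα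
    obtain ⟨C, hC, h⟩ := tsum_powWeight_neg_le (show 0 < 2 * α by linarith)
    refine ⟨C ^ (1 / 2 : ℝ), ENNReal.rpow_ne_top_of_nonneg (by norm_num) hC, fun b => ?_⟩
    have e : recip (min ∞ 2) = 1 / 2 := by simp [recip]
    rw [e, eLpNorm_count_top, eLpNorm_count_top]
    set S := ⨆ i, powWeight (α + 1 / 2) i * b i with hS
    refine iSup_le fun i => ?_
    have hb : ∀ l, b l ^ 2 ≤ S ^ 2 * powWeight (-1 - 2 * α) l := by
      intro l
      have h1 : powWeight (α + 1 / 2) l * b l ≤ S := le_iSup (fun i => powWeight (α + 1 / 2) i * b i) l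
      have h2 : b l = powWeight (-(α + 1 / 2)) l * (powWeight (α + 1 / 2) l * b l) := by
        rw [← mul_assoc, mul_comm (powWeight _ l), powWeight_mul_neg, one_mul]
      have h3 : b l ≤ powWeight (-(α + 1 / 2)) l * S := by
        rw [h2]; gcongr
      refine (pow_le_pow_left' h3 2).trans (le_of_eq ?_)
      rw [mul_pow, mul_comm, pow_two (powWeight _ _), ← powWeight_add]
      ring_nf
    calc powWeight α i * (∑' l, b (i + l) ^ 2) ^ (1 / 2 : ℝ)
        ≤ powWeight α i * (S ^ 2 * (C * powWeight (-(2 * α)) i)) ^ (1 / 2 : ℝ) := by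
          gcongr
          refine (ENNReal.tsum_le_tsum fun l => hb (i + l)).trans ?_
          rw [ENNReal.tsum_mul_left]
          gcongr
          exact h i
      _ = C ^ (1 / 2 : ℝ) * S := by
          rw [ENNReal.mul_rpow_of_nonneg _ _ (by norm_num),
            ENNReal.mul_rpow_of_nonneg _ _ (by norm_num), powWeight_rpow,
            ← ENNReal.rpow_natCast, ← ENNReal.rpow_mul]
          have e1 : -(2 * α) * (1 / 2) = -α := by ring
          have e2 : ((2 : ℕ) : ℝ) * (1 / 2) = 1 := by norm_num
          rw [e1, e2, ENNReal.rpow_one]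
          calc powWeight α i * (S * (C ^ (1 / 2 : ℝ) * powWeight (-α) i))
              = (powWeight α i * powWeight (-α) i) * (C ^ (1 / 2 : ℝ) * S) := by ring
            _ = _ := by rw [powWeight_mul_neg, one_mul]
  · have hr := ENNReal.toReal_pos hq hq'
    set r := q.toReal with hrdef
    have hrec : recip q = 1 / r := by simp [recip, ENNReal.toReal_inv, hrdef]
    -- This is the hypothesis α > -1/q, in the form the Hardy inequalities need.
    have hγ : 0 < α * r + 1 := by
      rw [hrec] at hα
      have : -(1 / r) * r < α * r := by gcongr
      have h2 : -(1 / r) * r = -1 := by field_simp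
      linarith
    have conv : ∀ (b : ℕ → ℝ≥0∞) (i : ℕ),
        (powWeight α i * (∑' l, b (i + l) ^ 2) ^ (1 / 2 : ℝ)) ^ r
          = powWeight (α * r + 1 - 1) i * (∑' l, b (i + l) ^ 2) ^ (r / 2) := by
      intro b i
      rw [ENNReal.mul_rpow_of_nonneg _ _ hr.le, powWeight_rpow, ← ENNReal.rpow_mul]
      ring_nf
    have conv2 : ∀ x : ℝ≥0∞, (x ^ 2) ^ (r / 2) = x ^ r := by
      intro x
      rw [← ENNReal.rpow_natCast, ← ENNReal.rpow_mul]
      congr 1; push_cast; ring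
    -- Hardy is applied to the squares with exponent q/2. The weight exponents produced are αq + 1 =
    -- (α + 1/q)q for q ≤ 2 and αq + q/2 = (α + 1/2)q for q > 2, hence the 1/min(q,2).
    rcases le_or_gt q 2 with h2 | h2
    · have hr2 : r ≤ 2 := by
        simpa using ENNReal.toReal_mono (by norm_num) h2
      obtain ⟨C, hC, h⟩ := hardy_of_le_one (p := r / 2) (by positivity) (by linarith) hγ
      refine ⟨C ^ (1 / r), ENNReal.rpow_ne_top_of_nonneg (by positivity) hC, fun b => ?_⟩
      refine eLpNorm_count_le_of_tsum_le hq hq' ?_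
      rw [min_eq_left h2, hrec, ← hrdef]
      simp only [conv]
      refine (h fun l => b l ^ 2).trans (le_of_eq ?_)
      congr 1
      refine tsum_congr fun l => ?_
      rw [conv2, ENNReal.mul_rpow_of_nonneg _ _ hr.le, powWeight_rpow]
      congr 2
      field_simp
    · have hr2 : 2 < r := by
        have := (ENNReal.toReal_lt_toReal (by norm_num) hq').mpr h2
        simpa using this
      obtain ⟨C, hC, h⟩ := hardy_of_one_lt (p := r / 2) (by linarith) hγ
      refine ⟨C ^ (1 / r), ENNReal.rpow_ne_top_of_nonneg (by positivity) hC, fun b => ?_⟩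
      refine eLpNorm_count_le_of_tsum_le hq hq' ?_
      have e : recip (min q 2) = 1 / 2 := by rw [min_eq_right h2.le]; simp [recip]
      rw [e, ← hrdef]
      simp only [conv]
      refine (h fun l => b l ^ 2).trans (le_of_eq ?_)
      congr 1
      refine tsum_congr fun l => ?_
      rw [conv2, ENNReal.mul_rpow_of_nonneg _ _ hr.le, powWeight_rpow]
      congr 2
      ring

lemma exists_powWeight_le_pow {a x : ℝ} (ha : 0 ≤ a) (hx : 1 < x) :
    ∃ C : ℝ≥0∞, C ≠ ∞ ∧ ∀ d : ℕ, powWeight a d ≤ C * ENNReal.ofReal x ^ d := by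
  set c := Real.log x / (a + 1) with hc
  have hlog : 0 < Real.log x := Real.log_pos hx
  have hc0 : 0 < c := by positivity
  set K := max 1 c⁻¹ with hK
  have hK0 : 0 < K := by positivity
  refine ⟨ENNReal.ofReal (K ^ a), by simp, fun d => ?_⟩
  unfold powWeight
  rw [← ENNReal.ofReal_pow (by linarith), ← ENNReal.ofReal_mul (by positivity)]
  refine ENNReal.ofReal_le_ofReal ?_
  have h1 : (d : ℝ) + 1 ≤ K * Real.exp (c * d) := by
    have h2 := Real.add_one_le_exp (c * d)
    have h3 : 1 ≤ K := le_max_left _ _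
    have h4 : c⁻¹ ≤ K := le_max_right _ _
    have h5 : (d : ℝ) ≤ K * (c * d) := by
      calc (d : ℝ) = c⁻¹ * (c * d) := by field_simp
        _ ≤ _ := by gcongr
    nlinarith
  calc ((d : ℝ) + 1) ^ a ≤ (K * Real.exp (c * d)) ^ a := by gcongr
    _ = K ^ a * Real.exp (c * d * a) := by
        rw [Real.mul_rpow hK0.le (Real.exp_pos _).le, ← Real.exp_mul]
    _ ≤ K ^ a * Real.exp (Real.log x * d) := by
        refine mul_le_mul_of_nonneg_left (Real.exp_le_exp.mpr ?_) (by positivity)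
        have : c * a ≤ Real.log x := by
          rw [hc, div_mul_eq_mul_div, div_le_iff₀ (by linarith)]
          nlinarith
        have hd : (0 : ℝ) ≤ d := Nat.cast_nonneg d
        nlinarith
    _ = K ^ a * x ^ d := by
        rw [mul_comm (Real.log x), Real.exp_nat_mul, Real.exp_log (by linarith)]

lemma powWeight_le_mul_abs (α : ℝ) (l d : ℕ) :
    powWeight α (l + d) ≤ powWeight α l * powWeight |α| d := by
  unfold powWeight
  rw [← ENNReal.ofReal_mul (by positivity)]
  refine ENNReal.ofReal_le_ofReal ?_
  have hl : (0 : ℝ) ≤ l := Nat.cast_nonneg l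
  have hd : (0 : ℝ) ≤ d := Nat.cast_nonneg d
  push_cast
  rcases le_or_gt 0 α with h | h
  · rw [abs_of_nonneg h, ← Real.mul_rpow (by positivity) (by positivity)]
    exact Real.rpow_le_rpow (by positivity) (by nlinarith) h
  · calc ((l : ℝ) + d + 1) ^ α ≤ (l + 1 : ℝ) ^ α :=
        Real.rpow_le_rpow_of_nonpos (by positivity) (by linarith) h.le
      _ ≤ _ := le_mul_of_one_le_right (by positivity)
        (Real.one_le_rpow (by linarith) (abs_nonneg _))

/-- Writing the kernel as σ^d · σ^d treats q < 1 and q ≥ 1 alike: one factor is summed, the other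
stays with y and is bounded by an l_q sum, which is then an l_1 convolution of q-th powers. -/
lemma eLpNorm_geometric_conv_le {q : ℝ≥0∞} (hq : q ≠ 0) {σ : ℝ≥0∞} (hσ : σ < 1) :
    ∃ C : ℝ≥0∞, C ≠ ∞ ∧ ∀ y : ℕ → ℝ≥0∞,
      eLpNorm (fun i => ∑ l ∈ Finset.range (i + 1), (σ ^ 2) ^ (i - l) * y l) q Measure.count
        ≤ C * eLpNorm y q Measure.count := by
  have hgeo : ∀ τ : ℝ≥0∞, τ < 1 → ∑' d : ℕ, τ ^ d ≠ ∞ := by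
    intro τ hτ
    rw [ENNReal.tsum_geometric]
    simpa [tsub_eq_zero_iff_le] using hτ
  have hK := hgeo σ hσ
  have bound : ∀ (y : ℕ → ℝ≥0∞) (i : ℕ) (s : ℝ≥0∞),
      (∀ l ∈ Finset.range (i + 1), σ ^ (i - l) * y l ≤ s) →
      ∑ l ∈ Finset.range (i + 1), (σ ^ 2) ^ (i - l) * y l ≤ (∑' d : ℕ, σ ^ d) * s := by
    intro y i s hs
    calc ∑ l ∈ Finset.range (i + 1), (σ ^ 2) ^ (i - l) * y l
        ≤ ∑ l ∈ Finset.range (i + 1), σ ^ (i - l) * s := by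
          refine Finset.sum_le_sum fun l hl => ?_
          rw [← pow_mul, mul_comm 2, pow_mul, pow_two, mul_assoc]
          gcongr
          exact hs l hl
      _ = (∑ l ∈ Finset.range (i + 1), σ ^ (i + 1 - 1 - l)) * s := by
          rw [Finset.sum_mul]; rfl
      _ ≤ _ := by
          rw [Finset.sum_range_reflect (fun d => σ ^ d)]
          gcongr
          exact ENNReal.sum_le_tsum _
  by_cases hq' : q = ∞
  · subst hq'
    refine ⟨_, hK, fun y => ?_⟩
    rw [eLpNorm_count_top, eLpNorm_count_top]
    refine iSup_le fun i => bound y i _ fun l _ => ?_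
    calc σ ^ (i - l) * y l ≤ 1 * y l := by gcongr; exact pow_le_one' hσ.le _
      _ ≤ _ := by rw [one_mul]; exact le_iSup y l
  · have hr := ENNReal.toReal_pos hq hq'
    set r := q.toReal with hrdef
    have hστ : σ ^ r < 1 := ENNReal.rpow_lt_one hσ hr
    refine ⟨((∑' d : ℕ, σ ^ d) ^ r * ∑' d : ℕ, (σ ^ r) ^ d) ^ (1 / r),
      ENNReal.rpow_ne_top_of_nonneg (by positivity) (ENNReal.mul_ne_top
        (ENNReal.rpow_ne_top_of_nonneg hr.le hK) (hgeo _ hστ)), fun y => ?_⟩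
    refine eLpNorm_count_le_of_tsum_le hq hq' ?_
    rw [mul_assoc, ← sum_range_antidiagonal_tsum_eq, ← ENNReal.tsum_mul_left]
    refine ENNReal.tsum_le_tsum fun i => ?_
    set s := (∑ l ∈ Finset.range (i + 1), (σ ^ r) ^ (i - l) * y l ^ r) ^ (1 / r) with hs
    have h := bound y i s (fun l hl => by
      rw [hs, one_div, ENNReal.le_rpow_inv_iff hr, ENNReal.mul_rpow_of_nonneg _ _ hr.le]
      have e : (σ ^ (i - l)) ^ r = (σ ^ r) ^ (i - l) := by
        rw [← ENNReal.rpow_natCast, ← ENNReal.rpow_natCast, ← ENNReal.rpow_mul,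
          ← ENNReal.rpow_mul, mul_comm]
      rw [e]
      exact Finset.single_le_sum (f := fun l => (σ ^ r) ^ (i - l) * y l ^ r)
        (fun _ _ => zero_le) hl)
    refine (ENNReal.rpow_le_rpow h hr.le).trans (le_of_eq ?_)
    rw [ENNReal.mul_rpow_of_nonneg _ _ hr.le, hs, ← ENNReal.rpow_mul, one_div_mul_cancel hr.ne',
      ENNReal.rpow_one]

/-- Discrete weighted Hardy inequality for geometrically damped partial sums. -/
lemma hardy_head {q : ℝ≥0∞} (hq : q ≠ 0) (α : ℝ) :
    ∃ C : ℝ≥0∞, C ≠ ∞ ∧ ∀ b : ℕ → ℝ≥0∞,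
      eLpNorm (fun i => powWeight α i * ∑ l ∈ Finset.range i, (2⁻¹ : ℝ≥0∞) ^ (i - l) * b l) q
        Measure.count ≤ C * eLpNorm (fun i => powWeight α i * b i) q Measure.count := by
  set σ : ℝ≥0∞ := ENNReal.ofReal (3 / 4) with hσ
  -- Moving the weight from i to l costs a power of i - l, absorbed by (9/8)^{i-l}; the kernel left
  -- is (1/2 · 9/8)^d = (3/4)^{2d}.
  obtain ⟨C₁, hC₁, h₁⟩ := exists_powWeight_le_pow (abs_nonneg α) (show (1 : ℝ) < 9 / 8 by norm_num)
  obtain ⟨C₂, hC₂, h₂⟩ := eLpNorm_geometric_conv_le (q := q) hq (σ := σ)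
    (by rw [hσ, ENNReal.ofReal_lt_one]; norm_num)
  refine ⟨C₁ * C₂, ENNReal.mul_ne_top hC₁ hC₂, fun b => ?_⟩
  rw [mul_assoc]
  refine le_trans ?_ (mul_le_mul_right (h₂ _) _)
  rw [← eLpNorm_enn_const_mul]
  refine eLpNorm_enn_mono fun i => ?_
  rw [Finset.mul_sum, Finset.mul_sum]
  refine (Finset.sum_le_sum_of_subset (Finset.range_mono (Nat.le_succ i))).trans ?_
  refine Finset.sum_le_sum fun l hl => ?_
  obtain ⟨d, rfl⟩ : ∃ d, i = l + d := ⟨i - l, by have := Finset.mem_range.mp hl; omega⟩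
  rw [add_tsub_cancel_left]
  have e : (2⁻¹ : ℝ≥0∞) ^ d * ENNReal.ofReal (9 / 8) ^ d = (σ ^ 2) ^ d := by
    rw [← mul_pow, hσ, ← ENNReal.ofReal_pow (by norm_num)]
    congr 1
    rw [show (2⁻¹ : ℝ≥0∞) = ENNReal.ofReal 2⁻¹ by
      rw [ENNReal.ofReal_inv_of_pos (by norm_num)]; simp, ← ENNReal.ofReal_mul (by norm_num)]
    norm_num
  calc powWeight α (l + d) * (2⁻¹ ^ d * b l)
      ≤ (powWeight α l * (C₁ * ENNReal.ofReal (9 / 8) ^ d)) * (2⁻¹ ^ d * b l) := by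
        gcongr
        exact (powWeight_le_mul_abs α l d).trans (by gcongr; exact h₁ d)
    _ = C₁ * ((2⁻¹ ^ d * ENNReal.ofReal (9 / 8) ^ d) * (powWeight α l * b l)) := by ring
    _ = _ := by rw [e]

/-! ### Distribution functions and the rearrangement of a function. -/

/-- Tonelli on the region under the graph; values ∞ are allowed because rearrangements are
`ℝ≥0∞`-valued. -/
lemma lintegral_eq_lintegral_meas_lt_enn {X : Type*} [MeasurableSpace X] (μ : Measure X) [SFinite μ]
    {F : X → ℝ≥0∞} (hF : Measurable F) :
    ∫⁻ a, F a ∂μ = ∫⁻ s in Ioi (0 : ℝ), μ {a | ENNReal.ofReal s < F a} := by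
  have hmeas : MeasurableSet {p : X × ℝ | ENNReal.ofReal p.2 < F p.1} :=
    measurableSet_lt (ENNReal.measurable_ofReal.comp measurable_snd) (hF.comp measurable_fst)
  have hvol : ∀ x : ℝ≥0∞, volume.restrict (Ioi (0 : ℝ)) {s : ℝ | ENNReal.ofReal s < x} = x := by
    intro x
    rw [Measure.restrict_apply (measurableSet_lt ENNReal.measurable_ofReal measurable_const)]
    by_cases hx : x = ∞
    · simp [hx]
    · have : {s : ℝ | ENNReal.ofReal s < x} ∩ Ioi 0 = Ioo 0 x.toReal := by
        ext s
        simp only [mem_inter_iff, mem_ofPred_eq, mem_Ioi, mem_Ioo]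
        constructor
        · rintro ⟨h1, h2⟩
          exact ⟨h2, (ENNReal.ofReal_lt_iff_lt_toReal h2.le hx).mp h1⟩
        · rintro ⟨h1, h2⟩
          exact ⟨(ENNReal.ofReal_lt_iff_lt_toReal h1.le hx).mpr h2, h1⟩
      rw [this, Real.volume_Ioo, sub_zero, ENNReal.ofReal_toReal hx]
  have h1 := Measure.prod_apply (μ := μ) (ν := volume.restrict (Ioi (0 : ℝ))) hmeas
  have h2 := Measure.prod_apply_symm (μ := μ) (ν := volume.restrict (Ioi (0 : ℝ))) hmeas
  rw [h1] at h2
  simp only [preimage_ofPred_eq, hvol] at h2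
  exact h2

lemma eLpNorm_two_le_of_distribution_le {X Y : Type*} [MeasurableSpace X] [MeasurableSpace Y]
    {μ : Measure X} [SFinite μ] {ν : Measure Y} [SFinite ν] {F : X → ℝ≥0∞} {H : Y → ℝ≥0∞}
    (hF : Measurable F) (hH : Measurable H) (h : ∀ s, μ {a | s < F a} ≤ ν {a | s < H a}) :
    eLpNorm F 2 μ ≤ eLpNorm H 2 ν := by
  have key := eLpNorm_le_of_lintegral_le (μ := μ) (ν := ν) (q := 2) (x := F) (y := H) (K := 1)
    (by norm_num) (by norm_num) (by
      rw [one_mul, lintegral_eq_lintegral_meas_lt_enn μ (hF.pow_const _),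
        lintegral_eq_lintegral_meas_lt_enn ν (hH.pow_const _)]
      refine lintegral_mono fun s => ?_
      have e : ∀ x : ℝ≥0∞, ENNReal.ofReal s < x ^ (2 : ℝ≥0∞).toReal ↔
          ENNReal.ofReal s ^ ((2 : ℝ≥0∞).toReal)⁻¹ < x := fun x => by
        rw [ENNReal.rpow_inv_lt_iff (by norm_num)]
      simp only [e]
      exact h _)
  simpa using key

lemma fnRearr_antitone (f : ℝ → ℂ) : Antitone (fnRearr f) := fun _ _ huv =>
  sInf_le_sInf fun _ hs => le_trans hs (ENNReal.ofReal_le_ofReal huv)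

lemma fnRearr_le_add {f h : ℝ → ℂ} {G : ℝ≥0∞}
    (hae : ∀ᵐ x ∂unitVol, ‖f x‖ₑ ≤ G + ‖h x‖ₑ) (u : ℝ) : fnRearr f u ≤ G + fnRearr h u := by
  unfold fnRearr
  rw [ENNReal.add_sInf]
  refine le_iInf₂ fun s hs => sInf_le ?_
  refine le_trans (measure_mono_ae ?_) hs
  filter_upwards [hae] with x hx hx2
  change G + s < ‖f x‖ₑ at hx2
  change s < ‖h x‖ₑ
  by_contra! hcon
  exact absurd hx2 (not_lt.mpr (hx.trans (by gcongr)))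

/-- The half of equimeasurability that is needed: if u is at least the measure m of the superlevel
set, then s is admissible in the infimum at u, so {h^* > s} lies in (0, m). -/
lemma volume_lt_fnRearr_le (h : ℝ → ℂ) (t : ℝ) (s : ℝ≥0∞) :
    volume.restrict (Ioo 0 t) {u | s < fnRearr h u} ≤ unitVol {x | s < ‖h x‖ₑ} := by
  set m := unitVol {x | s < ‖h x‖ₑ} with hm
  have hm1 : m ≠ ∞ := measure_ne_top _ _
  rw [Measure.restrict_apply' measurableSet_Ioo]
  calc volume ({u | s < fnRearr h u} ∩ Ioo 0 t) ≤ volume (Ioo 0 m.toReal) := by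
        refine measure_mono fun u hu => ⟨hu.2.1, ?_⟩
        rw [← ENNReal.ofReal_lt_iff_lt_toReal hu.2.1.le hm1]
        by_contra! hcon
        have hle : fnRearr h u ≤ s := sInf_le hcon
        exact absurd (show s < fnRearr h u from hu.1) (not_lt.mpr hle)
    _ = m := by rw [Real.volume_Ioo, sub_zero, ENNReal.ofReal_toReal hm1]

/-- A bounded part contributes √t G on (0, t), and an L_2 part at most its full norm. -/
lemma eLpNorm_fnRearr_le {f : ℝ → ℂ} {h : Lp ℂ 2 unitVol} {G : ℝ≥0∞}
    (hae : ∀ᵐ x ∂unitVol, ‖f x‖ₑ ≤ G + ‖h x‖ₑ) (t : ℝ) :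
    eLpNorm (fnRearr f) 2 (volume.restrict (Ioo 0 t))
      ≤ ENNReal.ofReal t ^ (1 / 2 : ℝ) * G + ‖h‖ₑ := by
  set ν := (volume : Measure ℝ).restrict (Ioo 0 t)
  calc eLpNorm (fnRearr f) 2 ν ≤ eLpNorm ((fun _ => G) + fnRearr h) 2 ν :=
        eLpNorm_enn_mono (fnRearr_le_add hae)
    _ ≤ eLpNorm (fun _ => G) 2 ν + eLpNorm (fnRearr h) 2 ν :=
        eLpNorm_add_le aestronglyMeasurable_const
          (fnRearr_antitone h).measurable.aestronglyMeasurable (by norm_num)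
    _ ≤ _ := by
        gcongr
        · rw [eLpNorm_eq_lintegral_rpow_enorm_toReal (by norm_num) (by norm_num)]
          simp only [enorm_eq_self, lintegral_const]
          rw [ENNReal.mul_rpow_of_nonneg _ _ (by norm_num), ← ENNReal.rpow_mul, mul_comm]
          simp [ν]
        · calc eLpNorm (fnRearr h) 2 ν ≤ eLpNorm (fun x => ‖h x‖ₑ) 2 unitVol :=
                eLpNorm_two_le_of_distribution_le (fnRearr_antitone h).measurable
                  (Lp.stronglyMeasurable h).enorm (volume_lt_fnRearr_le h t)
            _ = ‖h‖ₑ := by rw [Lp.enorm_def]; exact eLpNorm_enorm _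

/-! ### Rearrangement of a family and its level sets at the ranks 4^j. -/

section SequenceRearrangement

variable {ι : Type*}

lemma seqRearr_antitone (c : ι → ℂ) : Antitone (seqRearr c) := fun k l hkl =>
  sInf_le_sInf fun s (hs : {n | s < ‖c n‖ₑ}.encard < k) =>
    show {n | s < ‖c n‖ₑ}.encard < l from hs.trans_le (by exact_mod_cast hkl)

/-- The infimum is attained: k indices strictly above it would have a least modulus, leaving room
for an admissible level below that modulus. -/
lemma encard_lt_seqRearr (c : ι → ℂ) {k : ℕ} (hk : k ≠ 0) :
    {n | seqRearr c k < ‖c n‖ₑ}.encard < k := by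
  by_contra! hcon
  obtain ⟨T, hT, hTk⟩ := Set.exists_subset_encard_eq hcon
  have hfin : T.Finite := Set.finite_of_encard_eq_coe hTk
  have hne : T.Nonempty := by
    rw [← Set.encard_ne_zero, hTk]; exact_mod_cast hk
  obtain ⟨m, hmT, hm⟩ := Set.exists_min_image T (fun n => ‖c n‖ₑ) hfin hne
  have hlt : seqRearr c k < ‖c m‖ₑ := hT hmT
  obtain ⟨s, hs, hsm⟩ := sInf_lt_iff.mp hlt
  have hsub : T ⊆ {n | s < ‖c n‖ₑ} := fun n hn => lt_of_lt_of_le hsm (hm n hn)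
  exact absurd (lt_of_le_of_lt (Set.encard_le_encard hsub) hs) (by rw [hTk]; exact lt_irrefl _)

/-- The set of indices whose coefficient exceeds the `4^j`-th largest one. -/
def superlevel (c : ι → ℂ) (j : ℕ) : Set ι := {n | seqRearr c (4 ^ j) < ‖c n‖ₑ}

lemma superlevel_encard_lt (c : ι → ℂ) (j : ℕ) : (superlevel c j).encard < (4 ^ j : ℕ) :=
  encard_lt_seqRearr c (by positivity)

lemma superlevel_finite (c : ι → ℂ) (j : ℕ) : (superlevel c j).Finite :=
  Set.encard_ne_top_iff.mp (ne_top_of_lt (superlevel_encard_lt c j))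

lemma superlevel_zero (c : ι → ℂ) : superlevel c 0 = ∅ := by
  have := superlevel_encard_lt c 0
  rw [pow_zero, Nat.cast_one, Order.lt_one_iff, Set.encard_eq_zero] at this
  exact this

lemma enorm_le_of_notMem_superlevel {c : ι → ℂ} {j : ℕ} {n : ι} (h : n ∉ superlevel c j) :
    ‖c n‖ₑ ≤ seqRearr c (4 ^ j) := not_lt.mp h

/-- The step at which n enters the level sets pins |c_n| from above by the previous level, while
membership in the next set controls how many such n there are. -/
lemma exists_level {c : ι → ℂ} {i j : ℕ} {n : ι} (hij : i ≤ j) (hi : n ∉ superlevel c i)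
    (hj : n ∈ superlevel c j) :
    ∃ l, i ≤ l ∧ l < j ∧ n ∈ superlevel c (l + 1) ∧ ‖c n‖ₑ ≤ seqRearr c (4 ^ l) := by
  induction j, hij using Nat.le_induction with
  | base => exact absurd hj hi
  | succ j hij ih =>
    by_cases h : n ∈ superlevel c j
    · obtain ⟨l, h1, h2, h3⟩ := ih h
      exact ⟨l, h1, h2.trans (Nat.lt_succ_self j), h3⟩
    · exact ⟨j, hij, Nat.lt_succ_self j, hj, enorm_le_of_notMem_superlevel h⟩

/-- The dyadic blocks `2^j c_{4^j}^*`. -/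
noncomputable def block (c : ι → ℂ) (j : ℕ) : ℝ≥0∞ := 2 ^ j * seqRearr c (4 ^ j)

lemma tsum_indicator_superlevel_le (c : ι → ℂ) (l : ℕ) (x : ℝ≥0∞) :
    ∑' n, (superlevel c (l + 1)).indicator (fun _ => x) n ≤ 4 * (4 ^ l * x) := by
  rw [← tsum_subtype, ENNReal.tsum_set_const, ← mul_assoc, ← pow_succ']
  gcongr
  have := (superlevel_encard_lt c (l + 1)).le
  calc ((superlevel c (l + 1)).encard : ℝ≥0∞) ≤ (((4 ^ (l + 1) : ℕ) : ℕ∞) : ℝ≥0∞) := by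
        exact_mod_cast this
    _ = _ := by push_cast; rfl

lemma tsum_indicator_superlevel_compl_le {c : ι → ℂ}
    (hc : Filter.Tendsto (fun j => seqRearr c (4 ^ j)) Filter.atTop (nhds 0)) (i : ℕ) :
    ∑' n, ‖(superlevel c i)ᶜ.indicator c n‖ₑ ^ 2 ≤ 4 * ∑' l, block c (i + l) ^ 2 := by
  calc ∑' n, ‖(superlevel c i)ᶜ.indicator c n‖ₑ ^ 2
      ≤ ∑' n, ∑' l, (superlevel c (i + l + 1)).indicator
          (fun _ => seqRearr c (4 ^ (i + l)) ^ 2) n := by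
        refine ENNReal.tsum_le_tsum fun n => ?_
        by_cases hi : n ∈ superlevel c i
        · simp [hi]
        rw [Set.indicator_of_mem (show n ∈ (superlevel c i)ᶜ from hi)]
        by_cases hex : ∃ j, i ≤ j ∧ n ∈ superlevel c j
        · obtain ⟨j, hij, hj⟩ := hex
          obtain ⟨l, hl, -, hmem, hle⟩ := exists_level hij hi hj
          obtain ⟨d, rfl⟩ := Nat.exists_eq_add_of_le hl
          refine le_trans ?_ (ENNReal.le_tsum d)
          rw [Set.indicator_of_mem hmem]
          gcongr
        -- An index that never enters has |c_n| ≤ c*_{4^j} for all large j, so it vanishes.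
        · push Not at hex
          have h0 : ‖c n‖ₑ ≤ 0 := ge_of_tendsto hc
            (Filter.eventually_atTop.mpr ⟨i, fun j hj => enorm_le_of_notMem_superlevel (hex j hj)⟩)
          rw [nonpos_iff_eq_zero.mp h0]
          simp
    _ = ∑' l, ∑' n, (superlevel c (i + l + 1)).indicator
          (fun _ => seqRearr c (4 ^ (i + l)) ^ 2) n := ENNReal.tsum_comm
    _ ≤ ∑' l, 4 * block c (i + l) ^ 2 := by
        refine ENNReal.tsum_le_tsum fun l => (tsum_indicator_superlevel_le c (i + l) _).trans ?_
        refine le_of_eq ?_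
        rw [block, mul_pow, ← pow_mul, mul_comm (i + l) 2, pow_mul]
        norm_num
    _ = _ := ENNReal.tsum_mul_left

lemma tsum_indicator_superlevel_enorm_le (c : ι → ℂ) (i : ℕ) :
    ∑' n, (superlevel c i).indicator (fun n => ‖c n‖ₑ) n
      ≤ 4 * ∑ l ∈ Finset.range i, 2 ^ l * block c l := by
  calc ∑' n, (superlevel c i).indicator (fun n => ‖c n‖ₑ) n
      ≤ ∑' n, ∑ l ∈ Finset.range i, (superlevel c (l + 1)).indicator
          (fun _ => seqRearr c (4 ^ l)) n := by
        refine ENNReal.tsum_le_tsum fun n => ?_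
        by_cases hi : n ∈ superlevel c i
        · rw [Set.indicator_of_mem hi]
          obtain ⟨l, -, hl, hmem, hle⟩ := exists_level (Nat.zero_le i)
            (by simp [superlevel_zero]) hi
          refine le_trans ?_ (Finset.single_le_sum (f := fun l =>
            (superlevel c (l + 1)).indicator (fun _ => seqRearr c (4 ^ l)) n)
            (fun _ _ => zero_le) (Finset.mem_range.mpr hl))
          rw [Set.indicator_of_mem hmem]
          exact hle
        · simp [hi]
    _ = ∑ l ∈ Finset.range i, ∑' n, (superlevel c (l + 1)).indicator
          (fun _ => seqRearr c (4 ^ l)) n :=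
        Summable.tsum_finsetSum fun _ _ => ENNReal.summable
    _ ≤ ∑ l ∈ Finset.range i, 4 * (2 ^ l * block c l) := by
        refine Finset.sum_le_sum fun l _ => (tsum_indicator_superlevel_le c l _).trans ?_
        refine le_of_eq ?_
        rw [block, ← mul_assoc (2 ^ l), ← mul_pow]
        norm_num
    _ = _ := by rw [Finset.mul_sum]

end SequenceRearrangement

/-! ### Orthonormal series: head in L_∞, tail in L_2. -/

section Orthonormal

variable {ι : Type*} {φ : ι → Lp ℂ 2 unitVol}

lemma Orthonormal.summable_smul_of_tsum_ne_top (hφ : Orthonormal ℂ φ) {c : ι → ℂ}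
    (hc : ∑' n, ‖c n‖ₑ ^ 2 ≠ ∞) : Summable fun n => c n • φ n := by
  have h := hφ.orthogonalFamily.summable_iff_norm_sq_summable c
  simp only [LinearIsometry.toSpanSingleton_apply] at h
  rw [h]
  have h2 := ENNReal.summable_toReal hc
  simpa using h2

lemma Orthonormal.enorm_tsum_le (hφ : Orthonormal ℂ φ) {c : ι → ℂ}
    (hc : ∑' n, ‖c n‖ₑ ^ 2 ≠ ∞) :
    ‖∑' n, c n • φ n‖ₑ ≤ (∑' n, ‖c n‖ₑ ^ 2) ^ (1 / 2 : ℝ) := by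
  have hs := (hφ.summable_smul_of_tsum_ne_top hc).hasSum
  have hlim := (continuous_enorm.tendsto _).comp hs
  refine le_of_tendsto hlim (Filter.Eventually.of_forall fun T => ?_)
  have hn := hφ.orthogonalFamily.norm_sum c T
  simp only [LinearIsometry.toSpanSingleton_apply] at hn
  rw [one_div, ENNReal.le_rpow_inv_iff (by norm_num)]
  have e : ‖∑ n ∈ T, c n • φ n‖ₑ ^ 2 = ∑ n ∈ T, ‖c n‖ₑ ^ 2 := by
    simp only [← ofReal_norm]
    rw [← ENNReal.ofReal_pow (norm_nonneg _), hn, ENNReal.ofReal_sum_of_nonneg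
      (fun _ _ => by positivity)]
    simp only [ENNReal.ofReal_pow (norm_nonneg _)]
  simp only [Function.comp_apply, ENNReal.rpow_two]
  rw [e]
  exact ENNReal.sum_le_tsum T

lemma ae_enorm_sum_smul_le {K : ℝ≥0∞} (hK : ∀ n, ∀ᵐ x ∂unitVol, ‖φ n x‖ₑ ≤ K)
    (c : ι → ℂ) (T : Finset ι) :
    ∀ᵐ x ∂unitVol, ‖(∑ n ∈ T, c n • φ n : Lp ℂ 2 unitVol) x‖ₑ ≤ K * ∑ n ∈ T, ‖c n‖ₑ := by
  classical
  induction T using Finset.induction_on with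
  | empty =>
    filter_upwards [Lp.coeFn_zero ℂ 2 unitVol] with x hx
    rw [Finset.sum_empty, Finset.sum_empty, hx]
    simp
  | insert m T hm ih =>
    rw [Finset.sum_insert hm]
    filter_upwards [ih, hK m, Lp.coeFn_add (c m • φ m) (∑ n ∈ T, c n • φ n),
      Lp.coeFn_smul (c m) (φ m)] with x h1 h2 h3 h4
    rw [h3, Pi.add_apply, h4, Pi.smul_apply, Finset.sum_insert hm, mul_add]
    refine (enorm_add_le _ _).trans ?_
    gcongr
    rw [enorm_smul, mul_comm]
    gcongr

/-- The function `h` is the sum of the series over the complement of `S`. -/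
lemma ae_enorm_fourierInv_le (hφ : Orthonormal ℂ φ) {K : ℝ≥0∞}
    (hK : ∀ n, ∀ᵐ x ∂unitVol, ‖φ n x‖ₑ ≤ K) {c : ι → ℂ}
    (hc : ∑' n, ‖c n‖ₑ ^ 2 ≠ ∞) {S : Set ι} (hS : S.Finite) :
    ∃ h : Lp ℂ 2 unitVol, ‖h‖ₑ ≤ (∑' n, ‖Sᶜ.indicator c n‖ₑ ^ 2) ^ (1 / 2 : ℝ) ∧
      ∀ᵐ x ∂unitVol, ‖fourierInv φ c x‖ₑ ≤
        K * (∑' n, S.indicator (fun n => ‖c n‖ₑ) n) + ‖h x‖ₑ := by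
  have hc' : ∑' n, ‖Sᶜ.indicator c n‖ₑ ^ 2 ≠ ∞ := by
    refine ne_top_of_le_ne_top hc (ENNReal.tsum_le_tsum fun n => ?_)
    gcongr
    exact enorm_indicator_le_enorm_self c n
  refine ⟨∑' n, Sᶜ.indicator c n • φ n, hφ.enorm_tsum_le hc', ?_⟩
  have hsum1 : HasSum (fun n => S.indicator c n • φ n) (∑ n ∈ hS.toFinset, c n • φ n) := by
    have : HasSum (fun n => S.indicator c n • φ n)
        (∑ n ∈ hS.toFinset, S.indicator c n • φ n) := hasSum_sum_of_ne_finset_zero (fun n hn => by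
        have : n ∉ S := by simpa using hn
        simp [this])
    convert this using 1
    refine Finset.sum_congr rfl fun n hn => ?_
    have : n ∈ S := by simpa using hn
    simp [this]
  have hsum2 := (hφ.summable_smul_of_tsum_ne_top hc').hasSum
  have hdecomp : fourierInv φ c = (∑ n ∈ hS.toFinset, c n • φ n) +
      ∑' n, Sᶜ.indicator c n • φ n := by
    rw [← (hsum1.add hsum2).tsum_eq, fourierInv]
    refine tsum_congr fun n => ?_
    rw [← add_smul, ← Pi.add_apply, Set.indicator_self_add_compl]
  rw [hdecomp]
  filter_upwards [ae_enorm_sum_smul_le hK c hS.toFinset,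
    Lp.coeFn_add (∑ n ∈ hS.toFinset, c n • φ n) (∑' n, Sᶜ.indicator c n • φ n)] with x h1 h2
  rw [h2, Pi.add_apply]
  refine (enorm_add_le _ _).trans ?_
  gcongr
  refine h1.trans ?_
  gcongr
  calc ∑ n ∈ hS.toFinset, ‖c n‖ₑ = ∑ n ∈ hS.toFinset, S.indicator (fun n => ‖c n‖ₑ) n := by
        refine Finset.sum_congr rfl fun n hn => ?_
        have : n ∈ S := by simpa using hn
        simp [this]
    _ ≤ _ := ENNReal.sum_le_tsum _

/-- The cut `i` is independent of t; this freedom is what later lets the bound K be absorbed. -/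
lemma eLpNorm_fnRearr_fourierInv_le (hφ : Orthonormal ℂ φ) {K : ℝ≥0∞}
    (hK : ∀ n, ∀ᵐ x ∂unitVol, ‖φ n x‖ₑ ≤ K) {c : ι → ℂ} (hc : ∑' n, ‖c n‖ₑ ^ 2 ≠ ∞)
    (hc0 : Filter.Tendsto (fun j => seqRearr c (4 ^ j)) Filter.atTop (nhds 0)) (t : ℝ) (i : ℕ) :
    eLpNorm (fnRearr (fourierInv φ c)) 2 (volume.restrict (Ioo 0 t)) ≤
      ENNReal.ofReal t ^ (1 / 2 : ℝ) * (K * (4 * ∑ l ∈ Finset.range i, 2 ^ l * block c l))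
        + 2 * (∑' l, block c (i + l) ^ 2) ^ (1 / 2 : ℝ) := by
  obtain ⟨h, hh, hae⟩ := ae_enorm_fourierInv_le hφ hK hc (superlevel_finite c i)
  refine (eLpNorm_fnRearr_le hae t).trans ?_
  gcongr
  · exact tsum_indicator_superlevel_enorm_le c i
  · refine hh.trans ((ENNReal.rpow_le_rpow (tsum_indicator_superlevel_compl_le hc0 i)
      (by norm_num)).trans (le_of_eq ?_))
    rw [ENNReal.mul_rpow_of_nonneg _ _ (by norm_num)]
    congr 1
    rw [show (4 : ℝ≥0∞) = 2 ^ (2 : ℝ) by norm_num, ← ENNReal.rpow_mul]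
    norm_num

end Orthonormal

/-! ### Discretisation of both norms at powers of 4. -/

lemma rpow_le_rpow_abs_mul {x y K : ℝ} (hx : 0 < x) (hy : 0 < y) (hK : 0 < K) (hxy : x ≤ K * y)
    (hyx : y ≤ K * x) (a : ℝ) : x ^ a ≤ K ^ |a| * y ^ a := by
  rcases le_or_gt 0 a with h | h
  · rw [abs_of_nonneg h, ← Real.mul_rpow hK.le hy.le]
    exact Real.rpow_le_rpow hx.le hxy h
  · rw [abs_of_neg h, Real.rpow_neg hK.le, ← Real.inv_rpow hK.le,
      ← Real.mul_rpow (by positivity) hy.le]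
    exact Real.rpow_le_rpow_of_nonpos (by positivity) (by rwa [inv_mul_le_iff₀ hK]) h.le

lemma one_le_log_four : 1 ≤ Real.log 4 ∧ Real.log 4 ≤ 2 := by
  have : Real.log 4 = 2 * Real.log 2 := by
    rw [show (4 : ℝ) = 2 ^ 2 by norm_num, Real.log_pow]; norm_num
  have h1 := Real.log_two_gt_d9
  have h2 := Real.log_two_lt_d9
  constructor <;> linarith

lemma recip_nonneg (q : ℝ≥0∞) : 0 ≤ recip q := ENNReal.toReal_nonneg

lemma recip_eq (q : ℝ≥0∞) : recip q = 1 / q.toReal := by simp [recip, ENNReal.toReal_inv]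

lemma log_weight_le {α γ : ℝ} (hγ : 0 ≤ γ) {j : ℕ} {t : ℝ} (h1 : (1 / 4 : ℝ) ^ (j + 1) < t)
    (h2 : t ≤ (1 / 4 : ℝ) ^ j) :
    ENNReal.ofReal (t ^ (-γ) * (1 + |Real.log t|) ^ α) ≤
      ENNReal.ofReal (4 ^ |α|) * ENNReal.ofReal (4 ^ (j + 1)) ^ γ * powWeight α j := by
  have ht : 0 < t := lt_trans (by positivity) h1
  obtain ⟨hl1, hl2⟩ := one_le_log_four
  have hj : (0 : ℝ) ≤ j := Nat.cast_nonneg j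
  have hlog4 : Real.log (1 / 4) = -Real.log 4 := by rw [one_div, Real.log_inv]
  have l1 : -((j + 1 : ℝ) * Real.log 4) ≤ Real.log t := by
    have := Real.log_le_log (by positivity) h1.le
    rw [Real.log_pow, hlog4] at this
    push_cast at this; linarith
  have l2 : Real.log t ≤ -(j * Real.log 4) := by
    have := Real.log_le_log ht h2
    rw [Real.log_pow, hlog4] at this
    linarith
  have habs : |Real.log t| = -Real.log t := abs_of_nonpos (by nlinarith)
  have hw : (1 + |Real.log t|) ^ α ≤ 4 ^ |α| * ((j : ℝ) + 1) ^ α := by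
    apply rpow_le_rpow_abs_mul (by positivity) (by positivity) (by norm_num) <;>
    · rw [habs]; nlinarith
  have ht2 : t ^ (-γ) ≤ (4 ^ (j + 1)) ^ γ := by
    rw [Real.rpow_neg ht.le, ← Real.inv_rpow ht.le]
    refine Real.rpow_le_rpow (by positivity) ?_ hγ
    rw [inv_le_comm₀ ht (by positivity)]
    calc ((4 : ℝ) ^ (j + 1))⁻¹ = (1 / 4) ^ (j + 1) := by rw [one_div, inv_pow]
      _ ≤ t := h1.le
  unfold powWeight
  rw [ENNReal.ofReal_rpow_of_pos (by positivity), ← ENNReal.ofReal_mul (by positivity),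
    ← ENNReal.ofReal_mul (by positivity)]
  refine ENNReal.ofReal_le_ofReal ?_
  calc t ^ (-γ) * (1 + |Real.log t|) ^ α
      ≤ (4 ^ (j + 1)) ^ γ * (4 ^ |α| * ((j : ℝ) + 1) ^ α) := by gcongr
    _ = _ := by ring

/-- Discretisation of a logarithmically weighted `L_q` norm of a monotone function. -/
lemma eLpNorm_log_weight_le {q : ℝ≥0∞} (hq : q ≠ 0) (α : ℝ) :
    ∃ C : ℝ≥0∞, C ≠ ∞ ∧ ∀ A : ℝ → ℝ≥0∞, Monotone A →
      eLpNorm (fun t : ℝ => ENNReal.ofReal (t ^ (-recip q) * (1 + |Real.log t|) ^ α) * A t) q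
          (volume.restrict (Ioo 0 1))
        ≤ C * eLpNorm (fun j => powWeight α j * A ((1 / 4) ^ j)) q Measure.count := by
  have pw : ∀ A : ℝ → ℝ≥0∞, Monotone A → ∀ (j : ℕ) (t : ℝ), (1 / 4 : ℝ) ^ (j + 1) < t →
      t ≤ (1 / 4 : ℝ) ^ j →
      ENNReal.ofReal (t ^ (-recip q) * (1 + |Real.log t|) ^ α) * A t ≤
        ENNReal.ofReal (4 ^ |α|) * ENNReal.ofReal (4 ^ (j + 1)) ^ recip q *
          (powWeight α j * A ((1 / 4) ^ j)) := by
    intro A hA j t h1 h2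
    rw [← mul_assoc]
    exact mul_le_mul' (log_weight_le (recip_nonneg q) h1 h2) (hA h2)
  by_cases hq' : q = ∞
  · subst hq'
    refine ⟨ENNReal.ofReal (4 ^ |α|), by simp, fun A hA => ?_⟩
    rw [eLpNorm_count_top, eLpNorm_exponent_top]
    refine essSup_le_of_ae_le _ ?_
    filter_upwards [ae_restrict_mem measurableSet_Ioo] with t ht
    obtain ⟨j, h1, h2⟩ := exists_nat_pow_near_of_lt_one ht.1 ht.2.le
      (show (0 : ℝ) < 1 / 4 by norm_num) (by norm_num)
    refine (pw A hA j t h1 h2).trans ?_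
    -- With 1/q = 0 the factor (4^{j+1})^{1/q} disappears; for finite q it is cancelled by the
    -- length of the interval.
    have e : recip ∞ = 0 := by simp [recip]
    rw [e, ENNReal.rpow_zero, mul_one]
    gcongr
    exact le_iSup (fun j => powWeight α j * A ((1 / 4) ^ j)) j
  · have hr := ENNReal.toReal_pos hq hq'
    set K : ℝ≥0∞ := ENNReal.ofReal (4 ^ |α|) ^ q.toReal * 4 with hK
    refine ⟨K ^ (1 / q.toReal), ENNReal.rpow_ne_top_of_nonneg (by positivity)
      (ENNReal.mul_ne_top (ENNReal.rpow_ne_top_of_nonneg hr.le ENNReal.ofReal_ne_top)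
        (by norm_num)), fun A hA => ?_⟩
    refine eLpNorm_le_of_lintegral_le hq hq' ?_
    rw [lintegral_count, ← ENNReal.tsum_mul_left]
    have hcov : Ioo (0 : ℝ) 1 ⊆ ⋃ j : ℕ, Ioc ((1 / 4 : ℝ) ^ (j + 1)) ((1 / 4) ^ j) := by
      intro t ht
      obtain ⟨j, h1, h2⟩ := exists_nat_pow_near_of_lt_one ht.1 ht.2.le
        (show (0 : ℝ) < 1 / 4 by norm_num) (by norm_num)
      exact mem_iUnion.mpr ⟨j, h1, h2⟩
    refine (lintegral_mono_set hcov).trans ((lintegral_iUnion_le _ _).trans ?_)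
    refine ENNReal.tsum_le_tsum fun j => ?_
    set Y := powWeight α j * A ((1 / 4) ^ j)
    calc ∫⁻ t in Ioc ((1 / 4 : ℝ) ^ (j + 1)) ((1 / 4) ^ j),
          (ENNReal.ofReal (t ^ (-recip q) * (1 + |Real.log t|) ^ α) * A t) ^ q.toReal
        ≤ ∫⁻ _ in Ioc ((1 / 4 : ℝ) ^ (j + 1)) ((1 / 4) ^ j),
          (ENNReal.ofReal (4 ^ |α|) ^ q.toReal * ENNReal.ofReal (4 ^ (j + 1)) * Y ^ q.toReal) := by
          refine setLIntegral_mono' measurableSet_Ioc fun t ht => ?_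
          refine (ENNReal.rpow_le_rpow (pw A hA j t ht.1 ht.2) hr.le).trans (le_of_eq ?_)
          rw [ENNReal.mul_rpow_of_nonneg _ _ hr.le, ENNReal.mul_rpow_of_nonneg _ _ hr.le,
            ← ENNReal.rpow_mul, recip_eq, one_div_mul_cancel hr.ne', ENNReal.rpow_one]
      _ ≤ (ENNReal.ofReal (4 ^ |α|) ^ q.toReal * ENNReal.ofReal (4 ^ (j + 1)) * Y ^ q.toReal) *
            ENNReal.ofReal ((1 / 4) ^ j) := by
          rw [setLIntegral_const, Real.volume_Ioc]
          gcongr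
          have : (0 : ℝ) ≤ (1 / 4) ^ (j + 1) := by positivity
          linarith
      _ = (ENNReal.ofReal (4 ^ |α|) ^ q.toReal *
            (ENNReal.ofReal (4 ^ (j + 1)) * ENNReal.ofReal ((1 / 4) ^ j))) * Y ^ q.toReal := by
          ring
      _ = K * Y ^ q.toReal := by
          rw [← ENNReal.ofReal_mul (by positivity), hK]
          have e : (4 : ℝ) ^ (j + 1) * (1 / 4) ^ j = 4 := by
            rw [pow_succ, mul_right_comm, ← mul_pow]; norm_num
          rw [e]
          norm_num

/-- Natural division gives 4^0 / 4 = 0, so the block j = 0 is {0} and the blocks tile an initial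
segment exactly. -/
lemma sum_sum_Ico_four_pow (g : ℕ → ℝ≥0∞) (J : ℕ) :
    ∑ j ∈ Finset.range (J + 1), ∑ n ∈ Finset.Ico (4 ^ j / 4) (4 ^ j), g n
      = ∑ n ∈ Finset.range (4 ^ J), g n := by
  induction J with
  | zero => simp
  | succ J ih =>
    rw [Finset.sum_range_succ, ih, pow_succ, Nat.mul_div_cancel _ (by norm_num),
      Finset.range_eq_Ico, Finset.range_eq_Ico, Finset.sum_Ico_consecutive _ (by positivity) (by omega)]

lemma tsum_sum_Ico_four_pow_le (g : ℕ → ℝ≥0∞) :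
    ∑' j, ∑ n ∈ Finset.Ico (4 ^ j / 4) (4 ^ j), g n ≤ ∑' n, g n := by
  rw [ENNReal.tsum_eq_iSup_nat]
  refine iSup_le fun J => ?_
  refine (Finset.sum_le_sum_of_subset (Finset.range_mono (Nat.le_succ J))).trans ?_
  rw [sum_sum_Ico_four_pow]
  exact ENNReal.sum_le_tsum _

lemma powWeight_mul_block_le {ι : Type*} (c : ι → ℂ) (β s : ℝ) {j n : ℕ}
    (hn : n ∈ Finset.Ico (4 ^ j / 4) (4 ^ j)) :
    powWeight β j * block c j ≤
      ENNReal.ofReal (4 ^ |β| * 4 ^ |1 / 2 - s|) * (4 ^ j) ^ s *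
        (ENNReal.ofReal (((n + 1 : ℕ) : ℝ) ^ (1 / 2 - s)
          * (1 + Real.log ((n + 1 : ℕ) : ℝ)) ^ β) * seqRearr c (n + 1)) := by
  obtain ⟨hn1, hn2⟩ := Finset.mem_Ico.mp hn
  set x : ℝ := ((n + 1 : ℕ) : ℝ) with hx
  have hx1 : 1 ≤ x := by rw [hx]; push_cast; linarith [(Nat.cast_nonneg n : (0 : ℝ) ≤ n)]
  have hx0 : 0 < x := by linarith
  have hxy : x ≤ 4 ^ j := by rw [hx]; exact_mod_cast hn2
  have hyx : (4 : ℝ) ^ j ≤ 4 * x := by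
    rw [hx]
    have : 4 ^ j ≤ 4 * (n + 1) := by omega
    exact_mod_cast this
  have hy1 : (1 : ℝ) ≤ 4 ^ j := one_le_pow₀ (by norm_num)
  obtain ⟨hl1, hl2⟩ := one_le_log_four
  have hlx0 : 0 ≤ Real.log x := Real.log_nonneg hx1
  have hlx1 : Real.log x ≤ j * Real.log 4 := by
    rw [← Real.log_pow]; exact Real.log_le_log hx0 hxy
  have hlx2 : j * Real.log 4 ≤ Real.log 4 + Real.log x := by
    rw [← Real.log_pow, ← Real.log_mul (by norm_num) hx0.ne']
    exact Real.log_le_log (by positivity) hyx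
  have hj : (0 : ℝ) ≤ j := Nat.cast_nonneg j
  have h1 : ((j : ℝ) + 1) ^ β ≤ 4 ^ |β| * (1 + Real.log x) ^ β := by
    apply rpow_le_rpow_abs_mul (by positivity) (by positivity) (by norm_num) <;> nlinarith
  have h2 : ((4 : ℝ) ^ j) ^ (1 / 2 - s) ≤ 4 ^ |1 / 2 - s| * x ^ (1 / 2 - s) :=
    rpow_le_rpow_abs_mul (by positivity) hx0 (by norm_num) hyx (by linarith) _
  have h3 : (2 : ℝ) ^ j = (4 ^ j) ^ s * ((4 : ℝ) ^ j) ^ (1 / 2 - s) := by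
    rw [← Real.rpow_add (by positivity), ← Real.rpow_natCast_mul (by norm_num)]
    rw [show (j : ℝ) * (s + (1 / 2 - s)) = (1 / 2) * j by ring, Real.rpow_mul_natCast (by norm_num),
      ← Real.sqrt_eq_rpow, show (4 : ℝ) = 2 ^ 2 by norm_num, Real.sqrt_sq (by norm_num)]
  have h4 : (4 ^ j : ℝ≥0∞) ^ s = ENNReal.ofReal ((4 ^ j) ^ s) := by
    rw [← ENNReal.ofReal_rpow_of_pos (by positivity), ENNReal.ofReal_pow (by norm_num)]
    norm_num
  have h5 : (2 : ℝ≥0∞) ^ j = ENNReal.ofReal (2 ^ j) := by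
    rw [ENNReal.ofReal_pow (by norm_num)]; norm_num
  rw [h4, block, powWeight, h5, ← mul_assoc, ← mul_assoc, ← ENNReal.ofReal_mul (by positivity),
    ← ENNReal.ofReal_mul (by positivity), ← ENNReal.ofReal_mul (by positivity)]
  refine mul_le_mul' (ENNReal.ofReal_le_ofReal ?_) (seqRearr_antitone c hn2)
  rw [h3]
  calc ((j : ℝ) + 1) ^ β * ((4 ^ j) ^ s * ((4 : ℝ) ^ j) ^ (1 / 2 - s))
      ≤ (4 ^ |β| * (1 + Real.log x) ^ β) * ((4 ^ j) ^ s * (4 ^ |1 / 2 - s| * x ^ (1 / 2 - s))) := by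
        gcongr
    _ = _ := by ring

/-- By monotonicity c*_{4^j} is at most every c*_{n+1} in the j-th block, where all weights are
comparable. For finite q one averages over the block; for q = ∞ a single term suffices. -/
lemma eLpNorm_block_le {q : ℝ≥0∞} (hq : q ≠ 0) (β : ℝ) :
    ∃ C : ℝ≥0∞, C ≠ ∞ ∧ ∀ (ι : Type) (c : ι → ℂ),
      eLpNorm (fun j => powWeight β j * block c j) q Measure.count ≤ C * lzSeqNorm 2 q β c := by
  have e2 : recip 2 = 1 / 2 := by simp [recip]
  set K := ENNReal.ofReal (4 ^ |β| * 4 ^ |1 / 2 - recip q|) with hK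
  have hKtop : K ≠ ∞ := ENNReal.ofReal_ne_top
  by_cases hq' : q = ∞
  · subst hq'
    refine ⟨K, hKtop, fun ι c => ?_⟩
    unfold lzSeqNorm
    rw [eLpNorm_count_top, eLpNorm_count_top, e2]
    refine iSup_le fun j => ?_
    -- Terms are indexed from 0, so rank 4^j sits at index 4^j - 1.
    have hmem : 4 ^ j - 1 ∈ Finset.Ico (4 ^ j / 4) (4 ^ j) := by
      have : 0 < 4 ^ j := by positivity
      rw [Finset.mem_Ico]; omega
    refine (powWeight_mul_block_le c β (recip ∞) hmem).trans ?_
    have e : recip ∞ = 0 := by simp [recip]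
    rw [← hK, e, ENNReal.rpow_zero, mul_one]
    gcongr
    exact le_iSup (fun n : ℕ => ENNReal.ofReal (((n + 1 : ℕ) : ℝ) ^ (1 / 2 - (0 : ℝ))
          * (1 + Real.log ((n + 1 : ℕ) : ℝ)) ^ β) * seqRearr c (n + 1)) (4 ^ j - 1)
  · have hr := ENNReal.toReal_pos hq hq'
    refine ⟨(2 * K ^ q.toReal) ^ (1 / q.toReal), ENNReal.rpow_ne_top_of_nonneg (by positivity)
      (ENNReal.mul_ne_top (by norm_num) (ENNReal.rpow_ne_top_of_nonneg hr.le hKtop)),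
      fun ι c => ?_⟩
    refine eLpNorm_count_le_of_tsum_le hq hq' ?_
    rw [e2]
    set g : ℕ → ℝ≥0∞ := fun n => (ENNReal.ofReal (((n + 1 : ℕ) : ℝ) ^ (1 / 2 - recip q)
          * (1 + Real.log ((n + 1 : ℕ) : ℝ)) ^ β) * seqRearr c (n + 1)) ^ q.toReal with hg
    refine le_trans ?_ (mul_le_mul_right (tsum_sum_Ico_four_pow_le g) _)
    rw [← ENNReal.tsum_mul_left]
    refine ENNReal.tsum_le_tsum fun j => ?_
    set Y := (powWeight β j * block c j) ^ q.toReal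
    have hpt : ∀ n ∈ Finset.Ico (4 ^ j / 4) (4 ^ j), Y ≤ K ^ q.toReal * 4 ^ j * g n := by
      intro n hn
      refine (ENNReal.rpow_le_rpow (powWeight_mul_block_le c β (recip q) hn) hr.le).trans
        (le_of_eq ?_)
      rw [ENNReal.mul_rpow_of_nonneg _ _ hr.le, ENNReal.mul_rpow_of_nonneg _ _ hr.le,
        ← ENNReal.rpow_mul (4 ^ j), recip_eq, one_div_mul_cancel hr.ne', ENNReal.rpow_one, hg, hK,
        recip_eq]
    have hsum := Finset.sum_le_sum hpt
    rw [Finset.sum_const, Nat.card_Ico, nsmul_eq_mul, ← Finset.mul_sum] at hsum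
    set N := 4 ^ j - 4 ^ j / 4 with hN
    have hpos : 0 < 4 ^ j := by positivity
    have hN0 : (N : ℝ≥0∞) ≠ 0 := by
      have : N ≠ 0 := by omega
      exact_mod_cast this
    -- The block has at least half of 4^j elements, so averaging over it cancels 4^j up to a factor
    -- 2.
    have h4N : (4 ^ j : ℝ≥0∞) ≤ 2 * N := by
      have : 4 ^ j ≤ 2 * N := by omega
      exact_mod_cast this
    rw [← ENNReal.mul_le_mul_iff_right hN0 (ENNReal.natCast_ne_top N)]
    refine hsum.trans ?_
    calc K ^ q.toReal * 4 ^ j * ∑ n ∈ Finset.Ico (4 ^ j / 4) (4 ^ j), g n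
        ≤ K ^ q.toReal * (2 * N) * ∑ n ∈ Finset.Ico (4 ^ j / 4) (4 ^ j), g n := by gcongr
      _ = _ := by ring

/-! ### The cost of shifting by m, and the choice of m in terms of M. -/

lemma powWeight_mono {a b : ℝ} (h : a ≤ b) (j : ℕ) : powWeight a j ≤ powWeight b j :=
  ENNReal.ofReal_le_ofReal (Real.rpow_le_rpow_of_exponent_le
    (by linarith [(Nat.cast_nonneg j : (0 : ℝ) ≤ j)]) h)

lemma powWeight_le_of_le (α : ℝ) {j m : ℕ} (h : j ≤ m) : powWeight α j ≤ powWeight |α| m := by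
  refine (powWeight_mono (le_abs_self α) j).trans (ENNReal.ofReal_le_ofReal ?_)
  gcongr

/-- Truncated subtraction makes the first m terms all equal to `U 0` up to weight. Those m copies
and the shifted sequence give the factor m + 1 for q-th powers, hence 1/q; comparing weights gives
|α|. -/
lemma eLpNorm_shift_le {q : ℝ≥0∞} (hq : q ≠ 0) (α : ℝ) (m : ℕ) (U : ℕ → ℝ≥0∞) :
    eLpNorm (fun j => powWeight α j * U (j - m)) q Measure.count ≤
      powWeight (|α| + recip q) m * eLpNorm (fun i => powWeight α i * U i) q Measure.count := by
  have hshift : ∀ i, powWeight α (i + m) * U (i + m - m) ≤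
      powWeight |α| m * (powWeight α i * U i) := by
    intro i
    rw [add_tsub_cancel_right, ← mul_assoc, mul_comm (powWeight |α| m)]
    gcongr
    exact powWeight_le_mul_abs α i m
  have hinit : ∀ j < m, powWeight α j * U (j - m) ≤ powWeight |α| m * (powWeight α 0 * U 0) := by
    intro j hj
    rw [Nat.sub_eq_zero_of_le hj.le, powWeight_zero_right, one_mul]
    gcongr
    exact powWeight_le_of_le α hj.le
  by_cases hq' : q = ∞
  · subst hq'
    have e : recip ∞ = 0 := by simp [recip]
    rw [eLpNorm_count_top, eLpNorm_count_top, e, add_zero]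
    refine iSup_le fun j => ?_
    rcases lt_or_ge j m with h | h
    · refine (hinit j h).trans ?_
      gcongr
      exact le_iSup (fun i => powWeight α i * U i) 0
    · obtain ⟨i, rfl⟩ := Nat.exists_eq_add_of_le' h
      refine (hshift i).trans ?_
      gcongr
      exact le_iSup (fun i => powWeight α i * U i) i
  · have hr := ENNReal.toReal_pos hq hq'
    set r := q.toReal with hrdef
    have e : powWeight (|α| + recip q) m = (powWeight (1 + |α| * r) m) ^ (1 / r) := by
      rw [powWeight_rpow, recip_eq, ← hrdef]
      congr 1; field_simp; ring
    rw [e]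
    refine eLpNorm_count_le_of_tsum_le hq hq' ?_
    rw [← hrdef]
    set N := ∑' i, (powWeight α i * U i) ^ r with hN
    have hsplit := Summable.sum_add_tsum_nat_add'
      (f := fun j => (powWeight α j * U (j - m)) ^ r) (k := m) ENNReal.summable
    rw [← hsplit]
    have h1 : ∑ j ∈ Finset.range m, (powWeight α j * U (j - m)) ^ r ≤
        m * (powWeight (|α| * r) m * N) := by
      calc ∑ j ∈ Finset.range m, (powWeight α j * U (j - m)) ^ r
          ≤ ∑ j ∈ Finset.range m, powWeight (|α| * r) m * N := by
            refine Finset.sum_le_sum fun j hj => ?_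
            refine (ENNReal.rpow_le_rpow (hinit j (Finset.mem_range.mp hj)) hr.le).trans ?_
            rw [ENNReal.mul_rpow_of_nonneg _ _ hr.le, powWeight_rpow]
            gcongr
            exact ENNReal.le_tsum (f := fun i => (powWeight α i * U i) ^ r) 0
        _ = _ := by simp
    have h2 : ∑' i, (powWeight α (i + m) * U (i + m - m)) ^ r ≤ powWeight (|α| * r) m * N := by
      rw [hN, ← ENNReal.tsum_mul_left]
      refine ENNReal.tsum_le_tsum fun i => ?_
      refine (ENNReal.rpow_le_rpow (hshift i) hr.le).trans (le_of_eq ?_)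
      rw [ENNReal.mul_rpow_of_nonneg _ _ hr.le, powWeight_rpow]
    refine (add_le_add h1 h2).trans (le_of_eq ?_)
    have e1 : powWeight 1 m = m + 1 := by
      rw [powWeight, Real.rpow_one, ← Nat.cast_succ, ENNReal.ofReal_natCast, Nat.cast_succ]
    rw [powWeight_add, e1]
    ring

lemma exists_one_add_log_rpow_le {γ : ℝ} (hγ : 0 ≤ γ) :
    ∃ C : ℝ, 1 ≤ C ∧ ∀ M : ℝ, 1 ≤ M → (1 + Real.log M) ^ γ ≤ C * M := by
  set g := max γ 1 with hg
  have hg1 : 1 ≤ g := le_max_right _ _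
  have hgγ : γ ≤ g := le_max_left _ _
  have hg0 : 0 < g := by linarith
  refine ⟨g ^ γ, Real.one_le_rpow hg1 hγ, fun M hM => ?_⟩
  have hlog := Real.log_nonneg hM
  have h1 : 1 + Real.log M ≤ g * Real.exp (Real.log M / g) := by
    have h2 := Real.add_one_le_exp (Real.log M / g)
    calc 1 + Real.log M ≤ g * (Real.log M / g + 1) := by
          rw [mul_add, mul_div_cancel₀ _ hg0.ne']; linarith
      _ ≤ _ := by gcongr
  calc (1 + Real.log M) ^ γ ≤ (g * Real.exp (Real.log M / g)) ^ γ := by gcongr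
    _ = g ^ γ * Real.exp (Real.log M / g * γ) := by
        rw [Real.mul_rpow hg0.le (Real.exp_pos _).le, ← Real.exp_mul]
    _ ≤ g ^ γ * Real.exp (Real.log M) := by
        refine mul_le_mul_of_nonneg_left (Real.exp_le_exp.mpr ?_) (by positivity)
        rw [div_mul_eq_mul_div, div_le_iff₀ hg0]
        gcongr
    _ = g ^ γ * M := by rw [Real.exp_log (by linarith)]

lemma exists_nat_powWeight_le {γ δ : ℝ} (hγ : 0 ≤ γ) (hγδ : γ ≤ δ) :
    ∃ C : ℝ, 0 < C ∧ ∀ M : ℝ, 1 ≤ M → ∃ m : ℕ, M ≤ 2 ^ m ∧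
      powWeight γ m ≤ ENNReal.ofReal (C * min M ((1 + Real.log M) ^ δ)) := by
  obtain ⟨C, hC, h⟩ := exists_one_add_log_rpow_le hγ
  -- Since 2 log 2 > 1, this m satisfies 2^m ≥ M, and m + 1 ≤ 2(1 + log M).
  refine ⟨2 ^ γ * C, by positivity, fun M hM => ⟨⌈2 * Real.log M⌉₊, ?_, ?_⟩⟩
  · have h1 := Nat.le_ceil (2 * Real.log M)
    have h2 := Real.log_two_gt_d9
    have h3 := Real.log_nonneg hM
    rw [← Real.log_le_log_iff (by linarith) (by positivity), Real.log_pow]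
    nlinarith
  · have h3 := Real.log_nonneg hM
    have h1 := (Nat.ceil_lt_add_one (show 0 ≤ 2 * Real.log M by linarith)).le
    refine ENNReal.ofReal_le_ofReal ?_
    calc ((⌈2 * Real.log M⌉₊ : ℝ) + 1) ^ γ ≤ (2 * (1 + Real.log M)) ^ γ := by
          gcongr; linarith
      _ = 2 ^ γ * (1 + Real.log M) ^ γ := Real.mul_rpow (by norm_num) (by linarith)
      _ ≤ 2 ^ γ * (C * min M ((1 + Real.log M) ^ δ)) := by
          gcongr
          rw [mul_min_of_nonneg _ _ (by linarith)]
          refine le_min (h M hM) ?_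
          calc (1 + Real.log M) ^ γ ≤ (1 + Real.log M) ^ δ :=
                Real.rpow_le_rpow_of_exponent_le (by linarith) hγδ
            _ ≤ _ := le_mul_of_one_le_left (by positivity) hC
      _ = _ := by ring

lemma half_pow_mul_sum_le {K : ℝ≥0∞} {m : ℕ} (hK : K ≤ 2 ^ m) (b : ℕ → ℝ≥0∞) (j : ℕ) :
    ENNReal.ofReal ((1 / 4) ^ j) ^ (1 / 2 : ℝ) *
        (K * (4 * ∑ l ∈ Finset.range (j - m), 2 ^ l * b l)) ≤
      4 * ∑ l ∈ Finset.range (j - m), (2⁻¹ : ℝ≥0∞) ^ (j - m - l) * b l := by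
  rcases le_total j m with h | h
  · simp [Nat.sub_eq_zero_of_le h]
  obtain ⟨i, rfl⟩ := Nat.exists_eq_add_of_le' h
  rw [add_tsub_cancel_right]
  have e1 : ENNReal.ofReal ((1 / 4) ^ (i + m)) ^ (1 / 2 : ℝ) = (2⁻¹ : ℝ≥0∞) ^ (i + m) := by
    rw [ENNReal.ofReal_rpow_of_pos (by positivity), ← Real.sqrt_eq_rpow,
      show ((1 : ℝ) / 4) ^ (i + m) = ((1 / 2) ^ (i + m)) ^ 2 by
        rw [← pow_mul, mul_comm, pow_mul]; norm_num,
      Real.sqrt_sq (by positivity), ENNReal.ofReal_pow (by norm_num), one_div,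
      ENNReal.ofReal_inv_of_pos (by norm_num)]
    norm_num
  have hinv : ∀ k : ℕ, (2⁻¹ : ℝ≥0∞) ^ k * 2 ^ k = 1 := fun k => by
    rw [← mul_pow, ENNReal.inv_mul_cancel (by norm_num) (by norm_num), one_pow]
  rw [e1]
  calc (2⁻¹ : ℝ≥0∞) ^ (i + m) * (K * (4 * ∑ l ∈ Finset.range i, 2 ^ l * b l))
      ≤ (2⁻¹ : ℝ≥0∞) ^ (i + m) * (2 ^ m * (4 * ∑ l ∈ Finset.range i, 2 ^ l * b l)) := by gcongr
    _ = ((2⁻¹ : ℝ≥0∞) ^ m * 2 ^ m) * (4 * ∑ l ∈ Finset.range i, 2⁻¹ ^ i * (2 ^ l * b l)) := by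
        rw [pow_add, ← Finset.mul_sum]; ring
    _ = 4 * ∑ l ∈ Finset.range i, 2⁻¹ ^ i * (2 ^ l * b l) := by rw [hinv, one_mul]
    _ = 4 * ∑ l ∈ Finset.range i, (2⁻¹ : ℝ≥0∞) ^ (i - l) * b l := by
        congr 1
        refine Finset.sum_congr rfl fun l hl => ?_
        obtain ⟨d, rfl⟩ := Nat.exists_eq_add_of_le (Finset.mem_range.mp hl).le
        rw [add_tsub_cancel_left]
        calc (2⁻¹ : ℝ≥0∞) ^ (l + d) * (2 ^ l * b l)
            = (2⁻¹ ^ l * 2 ^ l) * (2⁻¹ ^ d * b l) := by rw [pow_add]; ring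
          _ = 2⁻¹ ^ d * b l := by rw [hinv, one_mul]

/-! ### Assembly of the estimate. -/

lemma eLpNorm_head_add_tail_le {q : ℝ≥0∞} (hq : q ≠ 0) {α : ℝ} (hα : -recip q < α) :
    ∃ C : ℝ≥0∞, C ≠ ∞ ∧ ∀ b : ℕ → ℝ≥0∞,
      eLpNorm (fun i => powWeight α i *
          (4 * ∑ l ∈ Finset.range i, (2⁻¹ : ℝ≥0∞) ^ (i - l) * b l
            + 2 * (∑' l, b (i + l) ^ 2) ^ (1 / 2 : ℝ))) q Measure.count
        ≤ C * eLpNorm (fun i => powWeight (α + recip (min q 2)) i * b i) q Measure.count := by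
  obtain ⟨C₁, hC₁, h₁⟩ := hardy_head hq α
  obtain ⟨C₂, hC₂, h₂⟩ := hardy_tail hq hα
  refine ⟨q.LpAddConst * (4 * C₁ + 2 * C₂), ENNReal.mul_ne_top (ENNReal.LpAddConst_lt_top q).ne
    (by finiteness), fun b => ?_⟩
  set N := eLpNorm (fun i => powWeight (α + recip (min q 2)) i * b i) q Measure.count
  have hmono : eLpNorm (fun i => powWeight α i * b i) q Measure.count ≤ N :=
    eLpNorm_enn_mono fun i => by
      gcongr
      exact powWeight_mono (by linarith [recip_nonneg (min q 2)]) i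
  set H : ℕ → ℝ≥0∞ := fun i =>
    powWeight α i * ∑ l ∈ Finset.range i, (2⁻¹ : ℝ≥0∞) ^ (i - l) * b l with hH
  set T : ℕ → ℝ≥0∞ := fun i => powWeight α i * (∑' l, b (i + l) ^ 2) ^ (1 / 2 : ℝ) with hT
  have e : (fun i => powWeight α i * (4 * ∑ l ∈ Finset.range i, (2⁻¹ : ℝ≥0∞) ^ (i - l) * b l
      + 2 * (∑' l, b (i + l) ^ 2) ^ (1 / 2 : ℝ))) = (fun i => 4 * H i) + fun i => 2 * T i := by
    funext i
    simp only [Pi.add_apply, hH, hT]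
    ring
  rw [e]
  calc _ ≤ q.LpAddConst * (eLpNorm (fun i => 4 * H i) q Measure.count +
          eLpNorm (fun i => 2 * T i) q Measure.count) :=
        eLpNorm_add_le' (measurable_of_countable _).aestronglyMeasurable
          (measurable_of_countable _).aestronglyMeasurable q
    _ ≤ q.LpAddConst * (4 * (C₁ * N) + 2 * (C₂ * N)) := by
        rw [eLpNorm_enn_const_mul, eLpNorm_enn_const_mul]
        gcongr
        · exact (h₁ b).trans (by gcongr)
        · exact h₂ b
    _ = _ := by ring

/-- The entry i = 0 of the tail Hardy inequality is the full square sum, with weight 1. -/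
lemma tsum_block_sq_ne_top {q : ℝ≥0∞} (hq : q ≠ 0) {α : ℝ} (hα : -recip q < α) {ι : Type}
    {c : ι → ℂ} (hc : c ∈ lzSeq ι 2 q (α + recip (min q 2))) :
    ∑' l, block c l ^ 2 ≠ ∞ := by
  obtain ⟨C, hC, h⟩ := hardy_tail hq hα
  obtain ⟨C', hC', h'⟩ := eLpNorm_block_le hq (α + recip (min q 2))
  have hfin : eLpNorm (fun i => powWeight (α + recip (min q 2)) i * block c i) q Measure.count ≠ ∞ :=
    ne_top_of_le_ne_top (ENNReal.mul_ne_top hC' (ne_of_lt hc)) (h' ι c)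
  have h0 := ne_top_of_le_ne_top (ENNReal.mul_ne_top hC hfin)
    ((le_eLpNorm_count hq _ 0).trans (h (block c)))
  simp only [powWeight_zero_right, one_mul, zero_add] at h0
  intro htop
  rw [htop] at h0
  exact h0 (ENNReal.top_rpow_of_pos (by norm_num))

lemma tendsto_seqRearr_of_tsum_block_sq {ι : Type*} {c : ι → ℂ} (h : ∑' l, block c l ^ 2 ≠ ∞) :
    Filter.Tendsto (fun j => seqRearr c (4 ^ j)) Filter.atTop (nhds 0) := by
  have h1 := ENNReal.tendsto_atTop_zero_of_tsum_ne_top h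
  have h2 := (ENNReal.continuous_rpow_const (y := (1 / 2 : ℝ))).continuousAt.tendsto.comp h1
  rw [ENNReal.zero_rpow_of_pos (by norm_num)] at h2
  refine tendsto_of_tendsto_of_tendsto_of_le_of_le tendsto_const_nhds h2 (fun _ => zero_le) ?_
  intro j
  have e : (block c j ^ 2) ^ (1 / 2 : ℝ) = block c j := by
    rw [← ENNReal.rpow_natCast, ← ENNReal.rpow_mul]; norm_num
  change seqRearr c (4 ^ j) ≤ (block c j ^ 2) ^ (1 / 2 : ℝ)
  rw [e, block]
  exact le_mul_of_one_le_left' (one_le_pow₀ (by norm_num))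

lemma tsum_enorm_sq_ne_top {ι : Type*} {c : ι → ℂ} (h : ∑' l, block c l ^ 2 ≠ ∞) :
    ∑' n, ‖c n‖ₑ ^ 2 ≠ ∞ := by
  have h1 := tsum_indicator_superlevel_compl_le (tendsto_seqRearr_of_tsum_block_sq h) 0
  simp only [superlevel_zero, compl_empty, indicator_univ, zero_add] at h1
  exact ne_top_of_le_ne_top (ENNReal.mul_ne_top (by norm_num) h) h1

lemma leftNorm_two_eq (q : ℝ≥0∞) (α : ℝ) (f : ℝ → ℂ) :
    leftNorm 2 q α 2 f = eLpNorm (fun t : ℝ =>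
      ENNReal.ofReal (t ^ (-recip q) * (1 + |Real.log t|) ^ α) *
        eLpNorm (fnRearr f) 2 (volume.restrict (Ioo 0 t))) q (volume.restrict (Ioo 0 1)) := by
  simp [leftNorm]

/-- The bound by a power of `m`, where `2^m` dominates the system. -/
lemma leftNorm_fourierInv_le {q : ℝ≥0∞} (hq : q ≠ 0) {α : ℝ} (hα : -recip q < α) :
    ∃ C : ℝ≥0∞, C ≠ ∞ ∧ ∀ (ι : Type) (φ : ι → Lp ℂ 2 unitVol) (m : ℕ), Orthonormal ℂ φ →
      (∀ n, ∀ᵐ x ∂unitVol, ‖φ n x‖ₑ ≤ 2 ^ m) → ∀ c ∈ lzSeq ι 2 q (α + recip (min q 2)),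
        leftNorm 2 q α 2 (fourierInv φ c) ≤
          C * powWeight (|α| + recip q) m * lzSeqNorm 2 q (α + recip (min q 2)) c := by
  obtain ⟨C₁, hC₁, h₁⟩ := eLpNorm_log_weight_le hq α
  obtain ⟨C₂, hC₂, h₂⟩ := eLpNorm_head_add_tail_le hq hα
  obtain ⟨C₃, hC₃, h₃⟩ := eLpNorm_block_le hq (α + recip (min q 2))
  refine ⟨C₁ * C₂ * C₃, ENNReal.mul_ne_top (ENNReal.mul_ne_top hC₁ hC₂) hC₃,
    fun ι φ m hφ hm c hc => ?_⟩
  have hb := tsum_block_sq_ne_top hq hα hc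
  set A : ℝ → ℝ≥0∞ := fun t =>
    eLpNorm (fnRearr (fourierInv φ c)) 2 (volume.restrict (Ioo 0 t)) with hA
  have hAmono : Monotone A := fun s t hst =>
    eLpNorm_mono_measure _ (Measure.restrict_mono (Ioo_subset_Ioo_right hst) le_rfl)
  set U : ℕ → ℝ≥0∞ := fun i => 4 * ∑ l ∈ Finset.range i, (2⁻¹ : ℝ≥0∞) ^ (i - l) * block c l
            + 2 * (∑' l, block c (i + l) ^ 2) ^ (1 / 2 : ℝ)
  -- The cut is placed at j - m; for j ≤ m the head is empty and only the tail bound is used.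
  have hAU : ∀ j, A ((1 / 4) ^ j) ≤ U (j - m) := fun j =>
    (eLpNorm_fnRearr_fourierInv_le hφ hm (tsum_enorm_sq_ne_top hb)
      (tendsto_seqRearr_of_tsum_block_sq hb) _ (j - m)).trans
      (add_le_add (half_pow_mul_sum_le le_rfl _ j) le_rfl)
  rw [leftNorm_two_eq]
  calc _ ≤ C₁ * eLpNorm (fun j => powWeight α j * A ((1 / 4) ^ j)) q Measure.count := h₁ A hAmono
    _ ≤ C₁ * eLpNorm (fun j => powWeight α j * U (j - m)) q Measure.count := by
        gcongr
        exact eLpNorm_enn_mono fun j => by gcongr; exact hAU j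
    _ ≤ C₁ * (powWeight (|α| + recip q) m *
          (C₂ * (C₃ * lzSeqNorm 2 q (α + recip (min q 2)) c))) := by
        gcongr
        refine (eLpNorm_shift_le hq α m U).trans ?_
        gcongr
        refine (h₂ (block c)).trans ?_
        gcongr
        exact h₃ ι c
    _ = _ := by ring

/-- On a probability space the L_2 norm, here 1, is at most the L_∞ norm. -/
lemma one_le_of_orthonormal_of_eLpNorm_top_le {ι : Type*} {φ : ι → Lp ℂ 2 unitVol}
    (hφ : Orthonormal ℂ φ) {M : ℝ} (n : ι) (h : eLpNorm (φ n) ∞ unitVol ≤ ENNReal.ofReal M) :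
    1 ≤ M := by
  have : IsProbabilityMeasure unitVol := ⟨by simp⟩
  have h1 : ‖φ n‖ₑ = 1 := by rw [← ofReal_norm, hφ.1 n, ENNReal.ofReal_one]
  have h2 : ‖φ n‖ₑ ≤ ENNReal.ofReal M := by
    rw [Lp.enorm_def]
    exact (eLpNorm_le_eLpNorm_of_exponent_le le_top (Lp.aestronglyMeasurable _)).trans h
  rw [h1] at h2
  exact ENNReal.one_le_ofReal.mp h2

theorem corollary4p1 (q : ℝ≥0∞) (hq : q ≠ 0) (α : ℝ) (hα : -recip q < α)
    (ε : ℝ) (hε : 0 < ε) :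
    ∃ C : ℝ, 0 < C ∧
      ∀ (ι : Type) [Countable ι] [Infinite ι] (φ : ι → Lp ℂ 2 unitVol) (M : ℝ),
        Orthonormal ℂ φ →
        ⨆ n, eLpNorm (φ n) ∞ unitVol = ENNReal.ofReal M →
        ∀ c ∈ lzSeq ι 2 q (α + recip (min q 2)),
          Summable (fun n => c n • φ n) ∧
          (fourierInv φ c : ℝ → ℂ) ∈ leftSpace 2 q α 2 ∧
          leftNorm 2 q α 2 (fourierInv φ c) ≤
            ENNReal.ofReal (C * min M ((1 + Real.log M) ^ (|α| + ε + recip q)))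
              * lzSeqNorm 2 q (α + recip (min q 2)) c := by
  obtain ⟨C₁, hC₁, h₁⟩ := leftNorm_fourierInv_le hq hα
  obtain ⟨C₂, hC₂, h₂⟩ := exists_nat_powWeight_le (γ := |α| + recip q) (δ := |α| + ε + recip q)
    (add_nonneg (abs_nonneg α) (recip_nonneg q)) (by linarith)
  -- Adding 1 keeps the constant positive even if `C₁` is 0.
  refine ⟨(C₁.toReal + 1) * C₂, by positivity, fun ι _ _ φ M hφ hM c hc => ?_⟩
  have hle : ∀ n, eLpNorm (φ n) ∞ unitVol ≤ ENNReal.ofReal M := fun n => by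
    rw [← hM]; exact le_iSup (fun n => eLpNorm (φ n) ∞ unitVol) n
  have hM1 : 1 ≤ M := one_le_of_orthonormal_of_eLpNorm_top_le hφ (Classical.arbitrary ι) (hle _)
  obtain ⟨m, hm, hmw⟩ := h₂ M hM1
  have hbound : ∀ n, ∀ᵐ x ∂unitVol, ‖φ n x‖ₑ ≤ 2 ^ m := by
    intro n
    have h2m : ENNReal.ofReal M ≤ 2 ^ m := by
      refine (ENNReal.ofReal_le_ofReal hm).trans (le_of_eq ?_)
      rw [ENNReal.ofReal_pow (by norm_num)]; norm_num
    filter_upwards [ae_le_eLpNormEssSup (f := φ n) (μ := unitVol)] with x hx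
    refine hx.trans (le_trans ?_ h2m)
    rw [← eLpNorm_exponent_top]
    exact hle n
  have hmain : leftNorm 2 q α 2 (fourierInv φ c) ≤
      ENNReal.ofReal ((C₁.toReal + 1) * C₂ * min M ((1 + Real.log M) ^ (|α| + ε + recip q)))
        * lzSeqNorm 2 q (α + recip (min q 2)) c := by
    refine (h₁ ι φ m hφ hbound c hc).trans ?_
    gcongr
    rw [mul_assoc, ENNReal.ofReal_mul (by positivity)]
    refine mul_le_mul' ?_ hmw
    calc C₁ = ENNReal.ofReal C₁.toReal := (ENNReal.ofReal_toReal hC₁).symm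
      _ ≤ _ := ENNReal.ofReal_le_ofReal (by linarith)
  refine ⟨hφ.summable_smul_of_tsum_ne_top (tsum_enorm_sq_ne_top (tsum_block_sq_ne_top hq hα hc)),
    ⟨Lp.aestronglyMeasurable _, lt_of_le_of_lt hmain ?_⟩, hmain⟩
  exact ENNReal.mul_lt_top ENNReal.ofReal_lt_top hc
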